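/- All Lie algebras are over $\mathbb{C}$. Let $n\ge 1$, and let $a=(a_1,\dots,a_m)$ and $b=(b_1,\dots,b_t)$ be (possibly empty) sequences of positive integers with $\sum a_i\le n$ and $\sum b_i\le n$. **Seaweed.** Let $\hat a=(a_1,\dots,a_m,\,2(n-\sum a_i),\,a_m,\dots,a_1)$, and define $\hat b$ likewise. Cut $\{1,\dots,2n\}$ into consecutive blocks of sizes $\hat a$ (the $\hat a$-blocks), respectively $\hat b$ (the $\hat b$-blocks). A location $(i,j)$ is admissible if $i\ge j$ and $i,j$ lie in the same $\hat a$-block, or $i\le j$ and $i,j$ lie in the same $\hat b$-block. Let $\mathfrak{sp}(2n)$ be the Lie algebra of complex $2n\times 2n$ matrices $X$ with $X_{i,j}=-\varepsilon_i\varepsilon_j X_{2n-j+1,2n-i+1}$ for all $i,j$, where $\varepsilon_i=1$ for $i\le n$ and $\varepsilon_i=-1$ for $i>n$. The type-C seaweed $\mathfrak g=\mathfrak p_{2n}^C\frac{a_1|\dots|a_m}{b_1|\dots|b_t}$ is the Lie algebra of those $X\in\mathfrak{sp}(2n)$ whose entries vanish outside the admissible locations. Write $e_{i,j}$ for the matrix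 units and $e_{i,j}^*$ for the functional $X\mapsto X_{i,j}$ on $\mathfrak g$. **Meanders.** The meander $M_n^C(\mathfrak g)$ has vertices $v_1,\dots,v_n$. Cut the vertices into consecutive top blocks of sizes $a_1,\dots,a_m$ and consecutive bottom blocks of sizes $b_1,\dots,b_t$ (some vertices may be left over); in each block, join any two distinct vertices that are mirror images of each other in the block by an arc, drawn above for top blocks and below for bottom blocks. Every component is a path (possibly a single vertex) or a cycle. The tail is the set of all $v_i$ for which exactly one of $\sum a_j<i$ and $\sum b_j<i$ holds. The oriented full meander is built in the same way on $v_1,\dots,v_{2n}$ from $\hat a$ (top) and $\hat b$ (bottom), with top arcs directed from right to left and bottom arcs from left to right. **Homotopy type.** Starting from $\frac{a_1|\dots|a_m}{b_1|\dots|b_t}$ on $n$ vertices, apply the following moves as long as both sequences are non-empty: * if $a_1>2b_1$, pass to $\frac{a_1-2b_1|b_1|a_2|\dots|a_m}{b_2|\dots|b_t}$; * if $a_1=2b_1$, pass to $\frac{b_1|a_2|\dots|a_m}{b_2|\dots|b_t}$; * if $b_1<a_1<2b_1$, pass to $\frac{b_1|a_2|\dots|a_m}{2b_1-a_1|b_2|\dots|b_t}$;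 * if $a_1=b_1=c$, pass to $\frac{a_2|\dots|a_m}{b_2|\dots|b_t}$ (component deletion of size $c$); * if $a_1<b_1$, exchange the two sequences. The number of vertices drops by $b_1$, $b_1$, $a_1-b_1$, $c$ and $0$, respectively. Suppose that the component deletions have sizes $c_1,\dots,c_q$, and that the process ends on $k$ vertices with one sequence empty and the other equal to $(d_1,\dots,d_s)$. The homotopy type of $\mathfrak g$ is then $\mathcal H_C(c_1,\dots,c_q;\,d_1,\dots,d_s;\,2(k-\sum d_i))$, where a last entry $0$ is omitted. **Theorem.** Suppose that $\mathfrak g$ has homotopy type $\mathcal H_C(1;\,1,\dots,1)$; that is, there is exactly one component deletion and it has size $1$, $d_1=\dots=d_s=1$ for some $s\ge 0$, and $k=s$. Then there is a unique path $P$ in $M_n^C(\mathfrak g)$ with no endpoint in the tail. Let $V(P)$ be its vertex set, put $$\varphi_{(1)}=\sum_{v_i\in V(P)}e_{i,i}^*+\sum_{(v_i,v_j)}e_{i,j}^*\in\mathfrak g^*,$$ where the second sum is over all edges $(v_i,v_j)$ of the oriented full meander with $i\le n$ or $j\le n$, and let $B_{\varphi_{(1)}}(x,y)=\varphi_{(1)}([x,y])$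 for $x,y\in\mathfrak g$. Then $$\ker(B_{\varphi_{(1)}})=\operatorname{span}\Big\{\sum_{v_i\in V(P)}\left(e_{i,i}-e_{2n-i+1,2n-i+1}\right)\Big\}.$$ -/

import Mathlib

/-! Type-C seaweed algebras and their meanders.

A (partial) composition is a list of positive integers.  Vertices and matrix indices are
numbered from `0`, so the vertex `v_i` of the text is number `i - 1`, and the index
`2n - i + 1` of the text is `Fin.rev` of the index `i`. -/

-- Matrices carry the commutator bracket.
attribute [local instance 100] LieRing.ofAssociativeRing

namespace SeaweedC

/-- `c` is a partial composition of `n`. -/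
def IsPartialComposition (n : ℕ) (c : List ℕ) : Prop :=
  (∀ x ∈ c, 0 < x) ∧ c.sum ≤ n

/-- `i` and `j` lie in a common block, when `0, 1, 2, …` is cut into consecutive blocks whose
sizes are the entries of the list. -/
def SameBlock : List ℕ → ℕ → ℕ → Prop
  | [], _, _ => False
  | d :: c, i, j => (i < d ∧ j < d) ∨ (d ≤ i ∧ d ≤ j ∧ SameBlock c (i - d) (j - d))

/-- `i` and `j` are joined by an arc: they are distinct, lie in a common block, and are mirror
images of each other in that block. -/
def Arc : List ℕ → ℕ → ℕ → Prop
  | [], _, _ => False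
  | d :: c, i, j =>
      (i < d ∧ j < d ∧ i ≠ j ∧ i + j + 1 = d) ∨ (d ≤ i ∧ d ≤ j ∧ Arc c (i - d) (j - d))

/-- The palindromic composition `c₁ | … | c_m | 2(n - ∑ c) | c_m | … | c₁` of `2n`
(the middle block may be empty). -/
def fullComposition (n : ℕ) (c : List ℕ) : List ℕ :=
  c ++ (2 * (n - c.sum)) :: c.reverse

/-! ### The seaweed algebra -/

/-- Admissible locations: lower triangular positions in the diagonal blocks given by `a`, and
upper triangular positions in the diagonal blocks given by `b`. -/
def Admissible (n : ℕ) (a b : List ℕ) (i j : Fin (2 * n)) : Prop :=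
  (j ≤ i ∧ SameBlock (fullComposition n a) i j) ∨ (i ≤ j ∧ SameBlock (fullComposition n b) i j)

/-- The antidiagonal matrix with entries `1` in the first `n` rows, `-1` in the last `n` rows. -/
def antidiagForm (n : ℕ) : Matrix (Fin (2 * n)) (Fin (2 * n)) ℂ :=
  Matrix.of fun i j => if j = i.rev then (if (i : ℕ) < n then 1 else -1) else 0

/-- `sp(2n)`, the matrices `X` with `Xᵀ J = - J X` for the antidiagonal form `J`. -/
noncomputable def sp (n : ℕ) : LieSubalgebra ℂ (Matrix (Fin (2 * n)) (Fin (2 * n)) ℂ) :=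
  skewAdjointMatricesLieSubalgebra (antidiagForm n)

/-- Entrywise: `X_{i,j} = ∓ X_{2n-j+1,2n-i+1}`, with `-` on the two diagonal `n × n` quarters and
`+` on the other two, as in the Chevalley basis. -/
theorem mem_sp (n : ℕ) (X : Matrix (Fin (2 * n)) (Fin (2 * n)) ℂ) :
    X ∈ sp n ↔ ∀ i j, X i j = -(if (i : ℕ) < n then 1 else -1) *
      (if (j : ℕ) < n then 1 else -1) * X j.rev i.rev := by
  have e1 : X ∈ sp n ↔ X.transpose * antidiagForm n = antidiagForm n * (-X) := by
    simp [sp, Matrix.IsSkewAdjoint, Matrix.IsAdjointPair]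
  rw [e1, ← Matrix.ext_iff]
  have l : ∀ i j, (X.transpose * antidiagForm n) i j = X j.rev i * (if (j : ℕ) < n then -1 else 1) := by
    intro i j
    rw [Matrix.mul_apply, Finset.sum_eq_single j.rev]
    · have := j.2
      by_cases h : (j : ℕ) < n
      · simp [antidiagForm, h, Fin.val_rev]; omega
      · simp [antidiagForm, h, Fin.val_rev]; omega
    · intro b _ hb
      have : j ≠ b.rev := fun h => hb (by simp [h])
      simp [antidiagForm, this]
    · simp
  have r : ∀ i j, (antidiagForm n * (-X)) i j = (if (i : ℕ) < n then 1 else -1) * (- X i.rev j) := by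
    intro i j
    rw [Matrix.mul_apply, Finset.sum_eq_single i.rev]
    · simp [antidiagForm]
    · intro b _ hb
      simp [antidiagForm, hb]
    · simp
  simp only [l, r]
  constructor
  · intro H i j
    have := H i.rev j
    simp only [Fin.rev_rev, Fin.val_rev] at this
    have hi := i.2
    have hc : (2 * n - ((i : ℕ)+1) < n) ↔ ¬ (i : ℕ) < n := by omega
    rw [if_congr hc rfl rfl] at this
    split_ifs at this ⊢ <;>
      first | linear_combination this | linear_combination -this
  · intro H i j
    have := H i.rev j
    simp only [Fin.rev_rev, Fin.val_rev] at this
    have hi := i.2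
    have hc : (2 * n - ((i : ℕ)+1) < n) ↔ ¬ (i : ℕ) < n := by omega
    rw [if_congr hc rfl rfl] at this
    split_ifs at this ⊢ <;>
      first | linear_combination this | linear_combination -this

theorem SameBlock.trans {c : List ℕ} {i j k : ℕ} (h₁ : SameBlock c i j) (h₂ : SameBlock c j k) :
    SameBlock c i k := by
  induction c generalizing i j k with
  | nil => exact h₁
  | cons d c ih =>
    rcases h₁ with h₁ | h₁ <;> rcases h₂ with h₂ | h₂
    · exact Or.inl ⟨h₁.1, h₂.2⟩
    · omega
    · omega
    · exact Or.inr ⟨h₁.1, h₂.2.1, ih h₁.2.2 h₂.2.2⟩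

theorem SameBlock.symm {c : List ℕ} {i j : ℕ} (h : SameBlock c i j) : SameBlock c j i := by
  induction c generalizing i j with
  | nil => exact h
  | cons d c ih =>
    rcases h with h | h
    · exact Or.inl ⟨h.2, h.1⟩
    · exact Or.inr ⟨h.2.1, h.1, ih h.2.2⟩

theorem SameBlock.between {c : List ℕ} {i j k : ℕ} (h : SameBlock c i k) (hij : i ≤ j)
    (hjk : j ≤ k) : SameBlock c i j := by
  induction c generalizing i j k with
  | nil => exact h
  | cons d c ih =>
    rcases h with h | h
    · exact Or.inl ⟨h.1, by omega⟩
    · exact Or.inr ⟨h.1, by omega, ih h.2.2 (by omega) (by omega)⟩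

theorem Admissible.trans {n : ℕ} {a b : List ℕ} {i k j : Fin (2 * n)}
    (h₁ : Admissible n a b i k) (h₂ : Admissible n a b k j) : Admissible n a b i j := by
  rcases h₁ with ⟨l₁, s₁⟩ | ⟨l₁, s₁⟩ <;> rcases h₂ with ⟨l₂, s₂⟩ | ⟨l₂, s₂⟩
  · exact Or.inl ⟨l₂.trans l₁, s₁.trans s₂⟩
  · rcases le_total j i with h | h
    · exact Or.inl ⟨h, s₁.trans (s₁.symm.between l₂ h)⟩
    · exact Or.inr ⟨h, (s₂.between l₁ h).symm.trans s₂⟩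
  · rcases le_total j i with h | h
    · exact Or.inl ⟨h, (s₂.symm.between h l₁).symm⟩
    · exact Or.inr ⟨h, s₁.between h l₂⟩
  · exact Or.inr ⟨l₁.trans l₂, s₁.trans s₂⟩

/-- The matrices supported on the admissible locations. -/
def supportedMatrices (n : ℕ) (a b : List ℕ) :
    LieSubalgebra ℂ (Matrix (Fin (2 * n)) (Fin (2 * n)) ℂ) where
  carrier := {X | ∀ i j, ¬ Admissible n a b i j → X i j = 0}
  zero_mem' := fun _ _ _ => rfl
  add_mem' := fun hX hY i j h => by simp [hX i j h, hY i j h]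
  smul_mem' := fun c X hX i j h => by simp [hX i j h]
  lie_mem' := by
    intro X Y hX hY i j h
    have key : ∀ U V : Matrix (Fin (2 * n)) (Fin (2 * n)) ℂ,
        (∀ i j, ¬ Admissible n a b i j → U i j = 0) →
        (∀ i j, ¬ Admissible n a b i j → V i j = 0) → (U * V) i j = 0 := by
      intro U V hU hV
      rw [Matrix.mul_apply]
      refine Finset.sum_eq_zero fun k _ => ?_
      by_cases h₁ : Admissible n a b i k
      · have h₂ : ¬ Admissible n a b k j := fun h₂ => h (h₁.trans h₂)
        rw [hV k j h₂, mul_zero]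
      · rw [hU i k h₁, zero_mul]
    rw [Ring.lie_def, Matrix.sub_apply, key X Y hX hY, key Y X hY hX, sub_zero]

/-- The type-C seaweed `𝔭_{2n}^C (a / b)`. -/
noncomputable def seaweed (n : ℕ) (a b : List ℕ) :
    LieSubalgebra ℂ (Matrix (Fin (2 * n)) (Fin (2 * n)) ℂ) :=
  sp n ⊓ supportedMatrices n a b

/-- The Kirillov form `B_φ(x, y) = φ([x, y])`. -/
noncomputable def kirillovForm {L : Type*} [LieRing L] [LieAlgebra ℂ L]
    (φ : Module.Dual ℂ L) : LinearMap.BilinForm ℂ L :=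
  LinearMap.mk₂ ℂ (fun x y => φ ⁅x, y⁆)
    (fun x y z => by simp) (fun c x y => by simp) (fun x y z => by simp) (fun c x y => by simp)

/-! ### Meanders -/

theorem Arc.symm {c : List ℕ} {i j : ℕ} (h : Arc c i j) : Arc c j i := by
  induction c generalizing i j with
  | nil => exact h
  | cons d c ih =>
    rcases h with h | h
    · exact Or.inl ⟨h.2.1, h.1, h.2.2.1.symm, by omega⟩
    · exact Or.inr ⟨h.2.1, h.1, ih h.2.2⟩

theorem Arc.ne {c : List ℕ} {i j : ℕ} (h : Arc c i j) : i ≠ j := by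
  induction c generalizing i j with
  | nil => exact h.elim
  | cons d c ih =>
    rcases h with h | h
    · exact h.2.2.1
    · have := ih h.2.2
      omega

/-- The meander on the `n` vertices `v_1, …, v_n`: top arcs from `a`, bottom arcs from `b`. -/
def meander (n : ℕ) (a b : List ℕ) : SimpleGraph (Fin n) where
  Adj i j := Arc a i j ∨ Arc b i j
  symm := ⟨fun _ _ h => h.imp Arc.symm Arc.symm⟩
  loopless := ⟨fun _ h => h.elim (fun h => h.ne rfl) (fun h => h.ne rfl)⟩

/-- The vertices incident with at most one arc, that is, not with both a top and a bottom arc.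
Every component of a meander is a path or a cycle; its vertices of this kind are the endpoints
(an isolated vertex is a path, a doubled arc is a cycle). -/
def IsEndpoint (a b : List ℕ) (i : ℕ) : Prop :=
  ¬ ((∃ j, Arc a i j) ∧ (∃ j, Arc b i j))

/-- The tail: the vertices that lie beyond exactly one of the two partial compositions. -/
def InTail (a b : List ℕ) (i : ℕ) : Prop :=
  Xor (a.sum ≤ i) (b.sum ≤ i)

/-- `P` is a path of the meander (a component with an endpoint, hence not a cycle) none of whose
endpoints is in the tail. -/
def IsTailFreePath (n : ℕ) (a b : List ℕ) (P : (meander n a b).ConnectedComponent) : Prop :=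
  (∃ i ∈ P.supp, IsEndpoint a b i) ∧ ∀ i ∈ P.supp, IsEndpoint a b i → ¬ InTail a b i

/-- Directed edges of the oriented full meander on `2n` vertices, oriented counterclockwise:
top arcs from right to left, bottom arcs from left to right. -/
def OrientedFullEdge (n : ℕ) (a b : List ℕ) (i j : Fin (2 * n)) : Prop :=
  (j < i ∧ Arc (fullComposition n a) i j) ∨ (i < j ∧ Arc (fullComposition n b) i j)

/-! ### Winding down and the homotopy type -/

/-- `WindsDown n a b cs k r`: the winding-down moves, starting from the meander on `n` vertices of
fractional form `a / b`, perform component deletions of sizes `cs` (in this order) and end in a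
meander on `k` vertices, one of whose partial compositions is empty and the other one is `r`. -/
inductive WindsDown : ℕ → List ℕ → List ℕ → List ℕ → ℕ → List ℕ → Prop
  | done_bottom (n : ℕ) (a : List ℕ) : WindsDown n a [] [] n a
  | done_top (n : ℕ) (b : List ℕ) : WindsDown n [] b [] n b
  | pure_contraction (n x y : ℕ) (a b cs : List ℕ) (k : ℕ) (r : List ℕ) (h : 2 * y < x)
      (w : WindsDown (n - y) ((x - 2 * y) :: y :: a) b cs k r) :
      WindsDown n (x :: a) (y :: b) cs k r
  | block_elimination (n x y : ℕ) (a b cs : List ℕ) (k : ℕ) (r : List ℕ) (h : x = 2 * y)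
      (w : WindsDown (n - y) (y :: a) b cs k r) :
      WindsDown n (x :: a) (y :: b) cs k r
  | rotation_contraction (n x y : ℕ) (a b cs : List ℕ) (k : ℕ) (r : List ℕ)
      (h₁ : y < x) (h₂ : x < 2 * y)
      (w : WindsDown (n - (x - y)) (y :: a) ((2 * y - x) :: b) cs k r) :
      WindsDown n (x :: a) (y :: b) cs k r
  | component_deletion (n c : ℕ) (a b cs : List ℕ) (k : ℕ) (r : List ℕ)
      (w : WindsDown (n - c) a b cs k r) :
      WindsDown n (c :: a) (c :: b) (c :: cs) k r
  | flip (n x y : ℕ) (a b cs : List ℕ) (k : ℕ) (r : List ℕ) (h : x < y)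
      (w : WindsDown n (y :: b) (x :: a) cs k r) :
      WindsDown n (x :: a) (y :: b) cs k r

/-- The seaweed `𝔭_{2n}^C (a / b)` has homotopy type `H_C(cs, tails, aftertail)`, where `cs` are
the deleted components, `tails` the tail components, and `aftertail` is twice the number of
aftertail vertices (`0` stands for an absent aftertail component). -/
def HasHomotopyType (n : ℕ) (a b cs tails : List ℕ) (aftertail : ℕ) : Prop :=
  ∃ k, WindsDown n a b cs k tails ∧ aftertail = 2 * (k - tails.sum)

/-! ### The one-form and the generator of the kernel -/

/-- The vertex `v_i` of the meander, as an index of the `2n × 2n` matrices. -/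
def lift {n : ℕ} (i : Fin n) : Fin (2 * n) :=
  Fin.castLE (by omega) i

/-- The coordinate functional `e_{i,j}^*`. For an admissible location with `i + j ≤ 2n + 1` (in
numbering from `1`) it is the dual vector to the Chevalley basis vector of that location. -/
noncomputable def coord (n : ℕ) (a b : List ℕ) (i j : Fin (2 * n)) :
    Module.Dual ℂ (seaweed n a b) where
  toFun X := (X : Matrix (Fin (2 * n)) (Fin (2 * n)) ℂ) i j
  map_add' _ _ := rfl
  map_smul' _ _ := rfl

open Classical in
/-- The one-form `φ_(1)`, for the vertex set `V` of the path: the sum of the `e_{i,i}^*` over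
`v_i ∈ V` and of the `e_{i,j}^*` over all edges `(v_i, v_j)` of the oriented full meander with
`i ≤ n` or `j ≤ n` (in numbering from `1`). -/
noncomputable def phiOne (n : ℕ) (a b : List ℕ) (V : Set (Fin n)) :
    Module.Dual ℂ (seaweed n a b) :=
  ∑ i : Fin n with i ∈ V, coord n a b (lift i) (lift i) +
    ∑ p : Fin (2 * n) × Fin (2 * n) with
      OrientedFullEdge n a b p.1 p.2 ∧ ((p.1 : ℕ) < n ∨ (p.2 : ℕ) < n),
      coord n a b p.1 p.2

open Classical in
/-- `∑_{v_i ∈ V} (e_{i,i} - e_{2n-i+1,2n-i+1})`. -/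
noncomputable def hOne (n : ℕ) (V : Set (Fin n)) : Matrix (Fin (2 * n)) (Fin (2 * n)) ℂ :=
  ∑ i : Fin n with i ∈ V,
    (Matrix.single (lift i) (lift i) 1 - Matrix.single (lift i).rev (lift i).rev 1)

end SeaweedC

/-!
Under the trace form, `2 φ_(1)` is represented by a matrix `F ∈ sp(2n)` whose off-diagonal entries
are nonzero exactly at the transposed edges of the oriented full meander, so `X ∈ 𝔤` lies in the
kernel of the Kirillov form iff `[F, X]` vanishes at the transposes of the admissible locations.

The full meander is a meander of type A, and for type A this condition forces `X` to be diagonal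
and constant along the edges. This goes by induction on the number of vertices. If the first blocks
have different sizes, the first vertices are folded onto their mirror images, which contracts the
meander and replaces `F` by the form of the smaller meander. If the first blocks have the same size,
they split off, and a grading of the vertices that changes by `2` along every edge shows that their
size is `1`: two vertices joined by a top and a bottom edge would form a cycle. Such a grading of
the full meander exists for homotopy type `H_C(1; 1, …, 1)`, by winding down.

The diagonal of `X` is odd under the reflection of the full meander, hence vanishes on the tail. By
winding down again, a function on the vertices that is constant along the edges and zero on the tail
is determined by its value at one endpoint of `P`, so it is a multiple of the indicator of `P`.
-/

namespace SeaweedC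

open Finset (Ico mem_Ico)

/-- `i` and `j` are distinct mirror images of each other in the interval `[s, t)`. -/
def Mirrored (s t i j : ℕ) : Prop :=
  s ≤ i ∧ s ≤ j ∧ i < t ∧ j < t ∧ i ≠ j ∧ i + j + 1 = s + t

/-- The mirror image of `p` in the interval `[s, t)`, for `s ≤ p < t`. -/
def mirror (s t p : ℕ) : ℕ :=
  s + t - 1 - p

/-- `Arc c i j`, when the blocks of `c` are cut from the vertices `o, o + 1, …`.  Winding down a
meander then never renumbers the vertices that are left. -/
def ArcFrom (o : ℕ) (c : List ℕ) (i j : ℕ) : Prop :=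
  o ≤ i ∧ o ≤ j ∧ Arc c (i - o) (j - o)

/-- `SameBlock c i j`, when the blocks of `c` are cut from the vertices `o, o + 1, …`. -/
def SameBlockFrom (o : ℕ) (c : List ℕ) (i j : ℕ) : Prop :=
  o ≤ i ∧ o ≤ j ∧ SameBlock c (i - o) (j - o)

section Blocks

variable {o d i j : ℕ} {c : List ℕ}

theorem not_arcFrom_nil : ¬ ArcFrom o [] i j :=
  fun h => h.2.2

theorem not_sameBlockFrom_nil : ¬ SameBlockFrom o [] i j :=
  fun h => h.2.2

theorem arcFrom_cons :
    ArcFrom o (d :: c) i j ↔ Mirrored o (o + d) i j ∨ ArcFrom (o + d) c i j := by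
  simp only [ArcFrom, Arc, Mirrored, Nat.sub_sub]
  grind

theorem sameBlockFrom_cons :
    SameBlockFrom o (d :: c) i j ↔
      (o ≤ i ∧ o ≤ j ∧ i < o + d ∧ j < o + d) ∨ SameBlockFrom (o + d) c i j := by
  simp only [SameBlockFrom, SameBlock, Nat.sub_sub]
  grind

theorem arcFrom_zero : ArcFrom 0 c i j ↔ Arc c i j := by
  simp [ArcFrom]

theorem sameBlockFrom_zero : SameBlockFrom 0 c i j ↔ SameBlock c i j := by
  simp [SameBlockFrom]

theorem arcFrom_zero_cons : ArcFrom o (0 :: c) i j ↔ ArcFrom o c i j := by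
  simp only [ArcFrom, Arc, Nat.not_lt_zero, Nat.zero_le, Nat.sub_zero, false_and, true_and,
    false_or]

theorem sameBlockFrom_zero_cons : SameBlockFrom o (0 :: c) i j ↔ SameBlockFrom o c i j := by
  simp only [SameBlockFrom, SameBlock, Nat.not_lt_zero, Nat.zero_le, Nat.sub_zero, false_and,
    true_and, false_or]

theorem ArcFrom.symm (h : ArcFrom o c i j) : ArcFrom o c j i :=
  ⟨h.2.1, h.1, h.2.2.symm⟩

theorem arcFrom_one_cons : ArcFrom o (1 :: c) i j ↔ ArcFrom (o + 1) c i j := by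
  rw [arcFrom_cons, or_iff_right]
  unfold Mirrored
  omega

end Blocks

/-- The directed arcs of the meander of `a` and `b` on the vertices `o, o + 1, …`: top arcs go
from right to left, bottom arcs from left to right. -/
def DirectedArc (o : ℕ) (a b : List ℕ) (i j : ℕ) : Prop :=
  (j < i ∧ ArcFrom o a i j) ∨ (i < j ∧ ArcFrom o b i j)

/-- The vertices of the meander on `o, o + 1, …` that lie beyond exactly one composition. -/
def InTailFrom (o : ℕ) (a b : List ℕ) (i : ℕ) : Prop :=
  Xor (o + a.sum ≤ i) (o + b.sum ≤ i)

/-- The vertices of the meander on `o, o + 1, …` that do not meet both a top and a bottom arc. -/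
def IsEndpointFrom (o : ℕ) (a b : List ℕ) (i : ℕ) : Prop :=
  ¬ ((∃ j, ArcFrom o a i j) ∧ (∃ j, ArcFrom o b i j))

/-- `f` increases by `d` along every directed arc of the meander. -/
def IsGraded {R : Type*} [AddCommGroup R] (o : ℕ) (d : R) (a b : List ℕ) (f : ℕ → R) : Prop :=
  ∀ ⦃i j⦄, DirectedArc o a b i j → f j = f i + d

section Swap

variable {o i j : ℕ} {a b : List ℕ}

theorem DirectedArc.swap (h : DirectedArc o a b i j) : DirectedArc o b a j i :=
  h.elim (fun h => .inr ⟨h.1, h.2.symm⟩) (fun h => .inl ⟨h.1, h.2.symm⟩)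

theorem directedArc_zero_cons {i j : ℕ} : DirectedArc o (0 :: a) b i j ↔ DirectedArc o a b i j := by
  rw [DirectedArc, DirectedArc, arcFrom_zero_cons]

theorem directedArc_one_cons {i j : ℕ} :
    DirectedArc o (1 :: a) (1 :: b) i j ↔ DirectedArc (o + 1) a b i j := by
  rw [DirectedArc, DirectedArc, arcFrom_one_cons, arcFrom_one_cons]

theorem inTailFrom_comm : InTailFrom o a b i ↔ InTailFrom o b a i := by
  rw [InTailFrom, InTailFrom, xor_comm]

theorem IsGraded.swap {R : Type*} [AddCommGroup R] {d : R} {f : ℕ → R}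
    (h : IsGraded o d a b f) : IsGraded o d b a (-f) := by
  intro i j hij
  simp [h hij.swap]

end Swap

section Unwind

variable {o y z i j : ℕ} {a b : List ℕ}

theorem arcFrom_unwind_top :
    ArcFrom (o + min y z) ((z - y) :: y :: a) i j ↔
      Mirrored (o + min y z) (o + z) i j ∨ Mirrored (o + z) (o + (y + z)) i j ∨
        ArcFrom (o + (y + z)) a i j := by
  rw [arcFrom_cons, arcFrom_cons, show o + min y z + (z - y) = o + z by omega,
    show o + z + y = o + (y + z) by omega]

theorem arcFrom_unwind_bottom :
    ArcFrom (o + min y z) ((y - z) :: b) i j ↔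
      Mirrored (o + min y z) (o + y) i j ∨ ArcFrom (o + y) b i j := by
  rw [arcFrom_cons, show o + min y z + (y - z) = o + y by omega]

theorem mirrored_top_iff :
    Mirrored (o + min y z) (o + z) i j ↔ o + y ≤ i ∧ o + y ≤ j ∧ Mirrored o (o + (y + z)) i j := by
  unfold Mirrored
  omega

theorem mirrored_bottom_iff :
    Mirrored (o + min y z) (o + y) i j ↔
      (o + z ≤ i ∧ i < o + (y + z)) ∧ (o + z ≤ j ∧ j < o + (y + z)) ∧
        Mirrored o (o + (y + z)) (mirror o (o + (y + z)) i) (mirror o (o + (y + z)) j) := by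
  unfold Mirrored mirror
  omega

theorem mirrored_mirror_iff :
    Mirrored (o + z) (o + (y + z)) i j ↔
      (o + z ≤ i ∧ i < o + (y + z)) ∧ (o + z ≤ j ∧ j < o + (y + z)) ∧
        Mirrored o (o + y) (mirror o (o + (y + z)) i) (mirror o (o + (y + z)) j) := by
  unfold Mirrored mirror
  omega

theorem directedArc_cons_cons_iff_of_ge (hi : o + y ≤ i) :
    DirectedArc o ((y + z) :: a) (y :: b) i j ↔
      (j < i ∧ (Mirrored o (o + (y + z)) i j ∨ ArcFrom (o + (y + z)) a i j)) ∨
        (i < j ∧ ArcFrom (o + y) b i j) := by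
  have not_bottom : ¬ Mirrored o (o + y) i j := fun h => h.2.2.1.not_ge hi
  rw [DirectedArc, arcFrom_cons, arcFrom_cons, or_iff_right not_bottom]

theorem directedArc_cons_cons_iff_of_lt (hi : i < o + y) :
    DirectedArc o ((y + z) :: a) (y :: b) i j ↔
      (j < i ∧ Mirrored o (o + (y + z)) i j) ∨ (i < j ∧ Mirrored o (o + y) i j) := by
  have not_top : ¬ ArcFrom (o + (y + z)) a i j := fun h => by have := h.1; omega
  have not_bottom : ¬ ArcFrom (o + y) b i j := fun h => by have := h.1; omega
  rw [DirectedArc, arcFrom_cons, arcFrom_cons, or_iff_left not_top, or_iff_left not_bottom]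

theorem directedArc_unwind_iff :
    DirectedArc (o + min y z) ((z - y) :: y :: a) ((y - z) :: b) i j ↔
      (o + y ≤ i ∧ o + y ≤ j ∧ DirectedArc o ((y + z) :: a) (y :: b) i j) ∨
      ((o + z ≤ i ∧ i < o + (y + z)) ∧ (o + z ≤ j ∧ j < o + (y + z)) ∧
        DirectedArc o ((y + z) :: a) (y :: b) (mirror o (o + (y + z)) i)
          (mirror o (o + (y + z)) j)) := by
  have top : ArcFrom (o + (y + z)) a i j → o + y ≤ i ∧ o + y ≤ j :=
    fun h => ⟨by have := h.1; omega, by have := h.2.1; omega⟩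
  have bottom : ArcFrom (o + y) b i j → o + y ≤ i ∧ o + y ≤ j := fun h => ⟨h.1, h.2.1⟩
  have inner (hi : o + y ≤ i) :=
    directedArc_cons_cons_iff_of_ge (z := z) (a := a) (b := b) (j := j) hi
  have outer (hi : o + z ≤ i ∧ i < o + (y + z)) (hj : o + z ≤ j ∧ j < o + (y + z)) :
      DirectedArc o ((y + z) :: a) (y :: b) (mirror o (o + (y + z)) i) (mirror o (o + (y + z)) j) ↔
        (i < j ∧ Mirrored o (o + (y + z)) (mirror o (o + (y + z)) i) (mirror o (o + (y + z)) j)) ∨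
        (j < i ∧ Mirrored o (o + y) (mirror o (o + (y + z)) i) (mirror o (o + (y + z)) j)) := by
    rw [directedArc_cons_cons_iff_of_lt (by unfold mirror; omega)]
    refine or_congr (and_congr_left' ?_) (and_congr_left' ?_) <;> unfold mirror <;> omega
  rw [DirectedArc, arcFrom_unwind_top, arcFrom_unwind_bottom, mirrored_top_iff,
    mirrored_mirror_iff, mirrored_bottom_iff]
  refine Iff.trans ?_ (or_congr
    (and_congr_right fun hi => and_congr_right fun _ => (inner hi).symm)
    (and_congr_right fun hi => and_congr_right fun hj => (outer hi hj).symm))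
  constructor
  · rintro (⟨h, ⟨hi, hj, m⟩ | ⟨hi, hj, m⟩ | m⟩ | ⟨h, ⟨hi, hj, m⟩ | m⟩)
    · exact .inl ⟨hi, hj, .inl ⟨h, .inl m⟩⟩
    · exact .inr ⟨hi, hj, .inr ⟨h, m⟩⟩
    · exact .inl ⟨(top m).1, (top m).2, .inl ⟨h, .inr m⟩⟩
    · exact .inr ⟨hi, hj, .inl ⟨h, m⟩⟩
    · exact .inl ⟨(bottom m).1, (bottom m).2, .inr ⟨h, m⟩⟩
  · rintro (⟨hi, hj, ⟨h, m | m⟩ | ⟨h, m⟩⟩ | ⟨hi, hj, ⟨h, m⟩ | ⟨h, m⟩⟩)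
    · exact .inl ⟨h, .inl ⟨hi, hj, m⟩⟩
    · exact .inl ⟨h, .inr (.inr m)⟩
    · exact .inr ⟨h, .inr m⟩
    · exact .inr ⟨h, .inl ⟨hi, hj, m⟩⟩
    · exact .inl ⟨h, .inr (.inl ⟨hi, hj, m⟩)⟩

theorem DirectedArc.sides_of_cons_cons
    (h : DirectedArc o ((y + z) :: a) (y :: b) i j) :
    (o + y ≤ i ∧ o + y ≤ j) ∨ (o ≤ i ∧ i < o + y ∧ o ≤ j ∧ j < o + y) ∨
      (j < o + y ∧ o + y ≤ i ∧ i < o + (y + z) ∧ j = mirror o (o + (y + z)) i) := by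
  rw [DirectedArc, arcFrom_cons, arcFrom_cons] at h
  simp only [ArcFrom] at h
  unfold Mirrored at h
  unfold mirror
  omega

end Unwind

section Transport

variable {R : Type*} [AddCommGroup R] {o y z : ℕ} {a b : List ℕ} {d : R} {f : ℕ → R}

theorem mirror_mirror {s t p : ℕ} (hs : s ≤ p) (ht : p < t) : mirror s t (mirror s t p) = p := by
  unfold mirror
  omega

theorem IsGraded.mirror_eq (h : IsGraded o d ((y + z) :: a) (y :: b) f) {p : ℕ}
    (hp : o + y ≤ p) (hp' : p < o + (y + z)) (hpm : mirror o (o + (y + z)) p < o + y) :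
    f (mirror o (o + (y + z)) p) = f p + d := by
  refine h (.inl ⟨by omega, arcFrom_cons.2 (.inl ?_)⟩)
  unfold Mirrored
  unfold mirror at *
  omega

theorem IsGraded.wind (h : IsGraded o d ((y + z) :: a) (y :: b) f) :
    IsGraded (o + min y z) d ((z - y) :: y :: a) ((y - z) :: b)
      (fun p => if o + y ≤ p then f p else f (mirror o (o + (y + z)) p) - d) := by
  have value_on_image {p : ℕ} (hp : o + z ≤ p ∧ p < o + (y + z)) :
      (if o + y ≤ p then f p else f (mirror o (o + (y + z)) p) - d) =
        f (mirror o (o + (y + z)) p) - d := by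
    split_ifs with hy
    · rw [h.mirror_eq hy hp.2 (by unfold mirror; omega), add_sub_cancel_right]
    · rfl
  intro i j hij
  rcases directedArc_unwind_iff.1 hij with ⟨hi, hj, arc⟩ | ⟨hi, hj, arc⟩
  · simpa only [if_pos hi, if_pos hj] using h arc
  · refine (value_on_image hj).trans ?_
    rw [h arc, add_sub_right_comm]
    exact congrArg (· + d) (value_on_image hi).symm

theorem IsGraded.unwind
    (h : IsGraded (o + min y z) d ((z - y) :: y :: a) ((y - z) :: b) f) :
    IsGraded o d ((y + z) :: a) (y :: b)
      (fun p => if o + y ≤ p then f p else f (mirror o (o + (y + z)) p) + d) := by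
  intro i j hij
  rcases hij.sides_of_cons_cons with ⟨hi, hj⟩ | ⟨hi, hi', hj, hj'⟩ | ⟨hj, hi, hi', rfl⟩
  · simpa only [if_pos hi, if_pos hj] using h (directedArc_unwind_iff.2 (.inl ⟨hi, hj, hij⟩))
  · simp only [if_neg hi'.not_ge, if_neg hj'.not_ge]
    rw [h (directedArc_unwind_iff.2 (.inr ⟨?_, ?_, ?_⟩))]
    · unfold mirror; omega
    · unfold mirror; omega
    · rwa [mirror_mirror hi (by omega), mirror_mirror hj (by omega)]
  · simp only [if_pos hi, if_neg hj.not_ge]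
    rw [mirror_mirror (by omega) hi']

theorem inTailFrom_unwind {i : ℕ} :
    InTailFrom (o + min y z) ((z - y) :: y :: a) ((y - z) :: b) i ↔
      InTailFrom o ((y + z) :: a) (y :: b) i := by
  simp only [InTailFrom, List.sum_cons,
    show o + min y z + (z - y + (y + a.sum)) = o + (y + z + a.sum) by omega,
    show o + min y z + (y - z + b.sum) = o + (y + b.sum) by omega]

end Transport

section Endpoints

variable {o y z i : ℕ} {a b : List ℕ}

theorem exists_mirrored {s t : ℕ} :
    (∃ j, Mirrored s t i j) ↔ s ≤ i ∧ i < t ∧ 2 * i + 1 ≠ s + t := by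
  constructor
  · rintro ⟨j, h⟩
    unfold Mirrored at h
    omega
  · intro h
    exact ⟨mirror s t i, by unfold Mirrored mirror; omega⟩

theorem exists_arcFrom_cons {d : ℕ} {c : List ℕ} :
    (∃ j, ArcFrom o (d :: c) i j) ↔
      (o ≤ i ∧ i < o + d ∧ 2 * i + 1 ≠ o + (o + d)) ∨ ∃ j, ArcFrom (o + d) c i j := by
  simp only [arcFrom_cons, exists_or, exists_mirrored]

/-- Unwinding moves a vertex `i` that comes from the folded block to its mirror image, unless the
bottom arc of `i` is not folded. -/
def unwindVertex (o y z i : ℕ) : ℕ :=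
  if i < o + y ∨ 2 * i + 1 = 2 * (o + z) + y then mirror o (o + (y + z)) i else i

theorem IsEndpointFrom.unwind (hi : o + min y z ≤ i)
    (h : IsEndpointFrom (o + min y z) ((z - y) :: y :: a) ((y - z) :: b) i) :
    IsEndpointFrom o ((y + z) :: a) (y :: b) (unwindVertex o y z i) := by
  have top {k : ℕ} : (∃ j, ArcFrom (o + (y + z)) a k j) → o + (y + z) ≤ k := fun ⟨_, h⟩ => h.1
  have bottom {k : ℕ} : (∃ j, ArcFrom (o + y) b k j) → o + y ≤ k := fun ⟨_, h⟩ => h.1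
  simp only [IsEndpointFrom, exists_arcFrom_cons,
    show o + min y z + (z - y) = o + z by omega, show o + min y z + (y - z) = o + y by omega,
    show o + z + y = o + (y + z) by omega] at h ⊢
  unfold unwindVertex
  rintro ⟨meets_top, meets_bottom⟩
  split_ifs at meets_top meets_bottom with hfold
  · have not_top := mt (top (k := mirror o (o + (y + z)) i))
    have not_bottom := mt (bottom (k := mirror o (o + (y + z)) i))
    unfold mirror at *
    rw [or_iff_left (not_top (by omega))] at meets_top
    rw [or_iff_left (not_bottom (by omega))] at meets_bottom
    refine h ⟨.inr (.inl (by omega)), .inl (by omega)⟩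
  · refine h ⟨?_, .inr (meets_bottom.resolve_left (by omega))⟩
    rcases meets_top with h | h
    · rcases lt_or_ge i (o + z) with hz | hz
      · exact .inl (by omega)
      · exact .inr (.inl (by omega))
    · exact .inr (.inr h)

end Endpoints

theorem WindsDown.offset_induction {N : ℕ} {motive : ℕ → List ℕ → List ℕ → ℕ → Prop}
    (base : ∀ o s, N ≤ o + s → motive o (List.replicate s 1) [] 0)
    (swap : ∀ {o a b q}, motive o a b q → motive o b a q)
    (zero_cons : ∀ {o a b q}, motive o a b q → motive o (0 :: a) b q)
    (unwind : ∀ {o y z a b q}, o + (y + z + a.sum) ≤ N →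
      motive (o + min y z) ((z - y) :: y :: a) ((y - z) :: b) q →
      motive o ((y + z) :: a) (y :: b) q)
    (delete : ∀ {o a b q}, o < N → motive (o + 1) a b q → motive o (1 :: a) (1 :: b) (q + 1))
    {n o k s : ℕ} {a b cs : List ℕ} (w : WindsDown n a b cs k (List.replicate s 1))
    (ones : ∀ c ∈ cs, c = 1) (hk : k ≤ s) (ha : a.sum ≤ n) (hb : b.sum ≤ n) (ho : o + n = N) :
    motive o a b cs.length := by
  generalize hr : List.replicate s 1 = r at w
  induction w generalizing o with
  | done_bottom n a =>
    subst hr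
    exact base o s (by omega)
  | done_top n b =>
    subst hr
    exact swap (base o s (by omega))
  | pure_contraction n x y a b cs k r h _ ih =>
    obtain ⟨z, rfl⟩ := Nat.exists_eq_add_of_le (show y ≤ x by omega)
    simp only [List.sum_cons] at ha hb ih
    refine unwind (by omega) ?_
    rw [Nat.sub_eq_zero_of_le (show y ≤ z by omega), min_eq_left (by omega)]
    rw [show y + z - 2 * y = z - y by omega] at ih
    exact swap (zero_cons (swap (ih ones hk (by omega) (by omega) (by omega) hr)))
  | block_elimination n x y a b cs k r h _ ih =>
    obtain rfl : x = y + y := by omega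
    simp only [List.sum_cons] at ha hb ih
    refine unwind (by omega) ?_
    rw [Nat.sub_self, min_self]
    exact zero_cons (swap (zero_cons (swap
      (ih ones hk (by omega) (by omega) (by omega) hr))))
  | rotation_contraction n x y a b cs k r h₁ h₂ _ ih =>
    obtain ⟨z, rfl⟩ := Nat.exists_eq_add_of_le h₁.le
    simp only [List.sum_cons] at ha hb ih
    refine unwind (by omega) ?_
    rw [Nat.sub_eq_zero_of_le (show z ≤ y by omega), min_eq_right (by omega)]
    rw [show 2 * y - (y + z) = y - z by omega] at ih
    exact zero_cons (ih ones hk (by omega) (by omega) (by omega) hr)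
  | component_deletion n c a b cs k r _ ih =>
    obtain ⟨rfl, ones'⟩ := List.forall_mem_cons.1 ones
    simp only [List.sum_cons] at ha hb
    exact delete (by omega) (ih ones' hk (by omega) (by omega) (by omega) hr)
  | flip n x y a b cs k r _ _ ih =>
    exact swap (ih ones hk hb ha ho hr)

theorem not_arcFrom_replicate_one {o s i j : ℕ} : ¬ ArcFrom o (List.replicate s 1) i j := by
  induction s generalizing o with
  | zero => exact not_arcFrom_nil
  | succ s ih => exact fun h => ih (arcFrom_one_cons.1 h)

theorem isGraded_replicate_one {R : Type*} [AddCommGroup R] {o s : ℕ} {d : R} {f : ℕ → R} :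
    IsGraded o d (List.replicate s 1) [] f :=
  fun _ _ h => h.elim (fun h => absurd h.2 not_arcFrom_replicate_one)
    (fun h => absurd h.2 not_arcFrom_nil)

theorem isGraded_zero_cons {R : Type*} [AddCommGroup R] {o : ℕ} {a b : List ℕ} {d : R}
    {f : ℕ → R} : IsGraded o d (0 :: a) b f ↔ IsGraded o d a b f := by
  simp only [IsGraded, directedArc_zero_cons]

theorem isGraded_one_cons {R : Type*} [AddCommGroup R] {o : ℕ} {a b : List ℕ} {d : R}
    {f : ℕ → R} : IsGraded o d (1 :: a) (1 :: b) f ↔ IsGraded (o + 1) d a b f := by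
  simp only [IsGraded, directedArc_one_cons]

/-- An integer grading of step `2` of the vertices `o, …, N - 1` of a meander, with the value `-1`
beyond `b` and `1` beyond `a`.  Its odd extension is a grading of step `2` of the full meander, so
the full meander has no cycles. -/
def HasTailGrading (N o : ℕ) (a b : List ℕ) : Prop :=
  ∃ g : ℕ → ℤ, IsGraded o 2 a b g ∧
    (∀ i < N, o + b.sum ≤ i → g i = -1) ∧ ∀ i < N, o + a.sum ≤ i → g i = 1

theorem HasTailGrading.swap {N o : ℕ} {a b : List ℕ} :
    HasTailGrading N o a b → HasTailGrading N o b a := by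
  rintro ⟨g, graded, neg, pos⟩
  exact ⟨-g, graded.swap, fun i hi h => by simp [pos i hi h],
    fun i hi h => by simp [neg i hi h]⟩

theorem HasTailGrading.unwind {N o y z : ℕ} {a b : List ℕ} :
    HasTailGrading N (o + min y z) ((z - y) :: y :: a) ((y - z) :: b) →
      HasTailGrading N o ((y + z) :: a) (y :: b) := by
  rintro ⟨g, graded, neg, pos⟩
  simp only [List.sum_cons] at neg pos
  refine ⟨_, graded.unwind, fun i hi h => ?_, fun i hi h => ?_⟩ <;> rw [List.sum_cons] at h <;>
    rw [if_pos (by omega)]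
  · exact neg i hi (by omega)
  · exact pos i hi (by omega)

theorem WindsDown.hasTailGrading {n k s : ℕ} {a b cs : List ℕ}
    (w : WindsDown n a b cs k (List.replicate s 1)) (ones : ∀ c ∈ cs, c = 1) (hk : k ≤ s)
    (ha : a.sum ≤ n) (hb : b.sum ≤ n) : HasTailGrading n 0 a b := by
  refine WindsDown.offset_induction (motive := fun o a b _ => HasTailGrading n o a b)
    (fun o s hs => ?_) .swap ?_ (fun _ => .unwind) ?_ w ones hk ha hb (zero_add n)
  · refine ⟨fun _ => -1, isGraded_replicate_one, fun _ _ _ => rfl, fun i hi h => ?_⟩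
    rw [List.sum_replicate, smul_eq_mul] at h
    omega
  · rintro o a b _ ⟨g, graded, neg, pos⟩
    exact ⟨g, isGraded_zero_cons.2 graded, neg, by simpa only [List.sum_cons, zero_add] using pos⟩
  · rintro o a b _ _ ⟨g, graded, neg, pos⟩
    refine ⟨g, isGraded_one_cons.2 graded, ?_, ?_⟩ <;>
      simpa only [List.sum_cons, ← add_assoc]

/-- `f` is constant along the arcs of the meander and vanishes on its tail. -/
def IsTailFreeInvariant {R : Type*} [AddCommGroup R] (o : ℕ) (a b : List ℕ) (f : ℕ → R) : Prop :=
  IsGraded o 0 a b f ∧ ∀ i, InTailFrom o a b i → f i = 0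

theorem InTailFrom.le_of_cons {o x y i : ℕ} {a b : List ℕ} (h : InTailFrom o (x :: a) (y :: b) i) :
    o + min x y ≤ i := by
  simp only [InTailFrom, List.sum_cons, Xor] at h
  omega

theorem unwind_apply {R : Type*} {o y z : ℕ} {f : ℕ → R} {i : ℕ} (hi : o + min y z ≤ i) :
    (if o + y ≤ unwindVertex o y z i then f (unwindVertex o y z i)
      else f (mirror o (o + (y + z)) (unwindVertex o y z i))) = f i := by
  unfold unwindVertex
  by_cases hfold : i < o + y ∨ 2 * i + 1 = 2 * (o + z) + y
  · rw [if_pos hfold, if_neg (by unfold mirror; omega), mirror_mirror (by omega) (by omega)]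
  · rw [if_neg hfold, if_pos (by omega)]

section Invariants

variable {R : Type*} [AddCommGroup R] {o y z : ℕ} {a b : List ℕ} {f : ℕ → R}

theorem IsTailFreeInvariant.swap (h : IsTailFreeInvariant o a b f) :
    IsTailFreeInvariant o b a f :=
  ⟨fun _ _ hij => by simpa using (h.1 hij.swap).symm, fun i hi => h.2 i (inTailFrom_comm.1 hi)⟩

theorem isTailFreeInvariant_zero_cons :
    IsTailFreeInvariant o (0 :: a) b f ↔ IsTailFreeInvariant o a b f := by
  simp only [IsTailFreeInvariant, isGraded_zero_cons, InTailFrom, List.sum_cons, zero_add]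

theorem isTailFreeInvariant_one_cons :
    IsTailFreeInvariant o (1 :: a) (1 :: b) f ↔ IsTailFreeInvariant (o + 1) a b f := by
  simp only [IsTailFreeInvariant, isGraded_one_cons, InTailFrom, List.sum_cons, add_assoc]

theorem IsTailFreeInvariant.wind (h : IsTailFreeInvariant o ((y + z) :: a) (y :: b) f) :
    IsTailFreeInvariant (o + min y z) ((z - y) :: y :: a) ((y - z) :: b)
      (fun p => if o + y ≤ p then f p else f (mirror o (o + (y + z)) p)) := by
  refine ⟨by simpa only [sub_zero] using h.1.wind, fun i hi => ?_⟩
  rw [inTailFrom_unwind] at hi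
  exact (if_pos (by have := hi.le_of_cons; omega)).trans (h.2 i hi)

theorem IsTailFreeInvariant.unwind
    (h : IsTailFreeInvariant (o + min y z) ((z - y) :: y :: a) ((y - z) :: b) f) :
    IsTailFreeInvariant o ((y + z) :: a) (y :: b)
      (fun p => if o + y ≤ p then f p else f (mirror o (o + (y + z)) p)) := by
  refine ⟨by simpa only [add_zero] using h.1.unwind, fun i hi => ?_⟩
  exact (if_pos (by have := hi.le_of_cons; omega)).trans (h.2 i (inTailFrom_unwind.2 hi))

theorem IsTailFreeInvariant.wind_apply_of_folded
    (h : IsTailFreeInvariant o ((y + z) :: a) (y :: b) f) {i : ℕ} (hi : o + z ≤ i)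
    (hi' : i < o + (y + z)) :
    (if o + y ≤ i then f i else f (mirror o (o + (y + z)) i)) = f (mirror o (o + (y + z)) i) := by
  split_ifs with hy
  · simpa using (h.1.mirror_eq hy hi' (by unfold mirror; omega)).symm
  · rfl

theorem IsTailFreeInvariant.wind_apply (h : IsTailFreeInvariant o ((y + z) :: a) (y :: b) f)
    {i : ℕ} (hi : o + min y z ≤ i) :
    (if o + y ≤ i then f i else f (mirror o (o + (y + z)) i)) = f (unwindVertex o y z i) := by
  unfold unwindVertex
  by_cases hfold : i < o + y ∨ 2 * i + 1 = 2 * (o + z) + y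
  · rw [if_pos hfold, h.wind_apply_of_folded (by omega) (by omega)]
  · rw [if_neg hfold, if_pos (by omega)]

theorem IsTailFreeInvariant.congr {g : ℕ → R} (h : IsTailFreeInvariant o a b f)
    (hfg : ∀ i, o ≤ i → g i = f i) : IsTailFreeInvariant o a b g := by
  refine ⟨fun i j arc => ?_, fun i hi => ?_⟩
  · have ⟨hi, hj⟩ : o ≤ i ∧ o ≤ j := arc.elim (fun h => ⟨h.2.1, h.2.2.1⟩) fun h => ⟨h.2.1, h.2.2.1⟩
    rw [hfg i hi, hfg j hj, h.1 arc]
  · rw [hfg i (hi.elim (fun h => by omega) fun h => by omega), h.2 i hi]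

end Invariants

/-- The points `p k`, one for each tail-free path of a meander on the vertices `o, …, N - 1`. -/
structure IsPathSystem (R : Type*) [AddCommGroup R] (N o : ℕ) (a b : List ℕ) {q : ℕ}
    (p : Fin q → ℕ) : Prop where
  le (k) : o ≤ p k
  lt (k) : p k < N
  isEndpoint (k) : IsEndpointFrom o a b (p k)
  exists_ne_zero : ∃ f : ℕ → R, IsTailFreeInvariant o a b f ∧ ∀ k, f (p k) ≠ 0
  eq_zero {f : ℕ → R} (h : IsTailFreeInvariant o a b f) (hp : ∀ k, f (p k) = 0) {i : ℕ}
    (hi : o ≤ i) (hi' : i < N) : f i = 0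

namespace IsPathSystem

variable {R : Type*} [AddCommGroup R] {N o y z q : ℕ} {a b : List ℕ} {p : Fin q → ℕ}

theorem replicate_one {s : ℕ} (h : N ≤ o + s) :
    IsPathSystem R N o (List.replicate s 1) [] (Fin.elim0 : Fin 0 → ℕ) where
  le k := k.elim0
  lt k := k.elim0
  isEndpoint k := k.elim0
  exists_ne_zero := ⟨0, ⟨isGraded_replicate_one, fun _ _ => rfl⟩, fun k => k.elim0⟩
  eq_zero {f} hf _ {i} hi hi' := by
    refine hf.2 i (.inr ⟨by simpa using hi, ?_⟩)
    rw [List.sum_replicate, smul_eq_mul]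
    omega

theorem swap (h : IsPathSystem R N o a b p) : IsPathSystem R N o b a p where
  le := h.le
  lt := h.lt
  isEndpoint k := fun meets => h.isEndpoint k meets.symm
  exists_ne_zero := h.exists_ne_zero.imp fun _ hf => hf.imp_left IsTailFreeInvariant.swap
  eq_zero hf := h.eq_zero hf.swap

theorem zero_cons (h : IsPathSystem R N o a b p) : IsPathSystem R N o (0 :: a) b p := by
  constructor
  · exact h.le
  · exact h.lt
  · simpa only [IsEndpointFrom, arcFrom_zero_cons] using h.isEndpoint
  · simpa only [isTailFreeInvariant_zero_cons] using h.exists_ne_zero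
  · simpa only [isTailFreeInvariant_zero_cons] using @h.eq_zero

theorem unwind (hN : o + (y + z + a.sum) ≤ N)
    (h : IsPathSystem R N (o + min y z) ((z - y) :: y :: a) ((y - z) :: b) p) :
    IsPathSystem R N o ((y + z) :: a) (y :: b) (unwindVertex o y z ∘ p) where
  le k := by
    have := h.le k
    simp only [Function.comp_apply, unwindVertex, mirror]
    split_ifs <;> omega
  lt k := by
    have := h.le k
    have := h.lt k
    simp only [Function.comp_apply, unwindVertex, mirror]
    split_ifs <;> omega
  isEndpoint k := (h.isEndpoint k).unwind (h.le k)
  exists_ne_zero := by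
    obtain ⟨f, hf, ne_zero⟩ := h.exists_ne_zero
    exact ⟨_, hf.unwind, fun k => (unwind_apply (h.le k)).trans_ne (ne_zero k)⟩
  eq_zero {f} hf hp {i} hi hi' := by
    have wound_eq_zero {j : ℕ} : o + min y z ≤ j → j < N → _ = (0 : R) :=
      h.eq_zero hf.wind fun k => (hf.wind_apply (h.le k)).trans (hp k)
    by_cases hy : o + y ≤ i
    · exact (if_pos hy).symm.trans (wound_eq_zero (by omega) hi')
    · rw [← mirror_mirror hi (by omega : i < o + (y + z)),
        ← hf.wind_apply_of_folded (by unfold mirror; omega) (by unfold mirror; omega)]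
      exact wound_eq_zero (by unfold mirror; omega) (by unfold mirror; omega)

theorem delete [Nontrivial R] (ho : o < N) (h : IsPathSystem R N (o + 1) a b p) :
    IsPathSystem R N o (1 :: a) (1 :: b) (Fin.cons o p : Fin (q + 1) → ℕ) where
  le := Fin.cases le_rfl fun k => (Nat.le_succ o).trans (h.le k)
  lt := Fin.cases ho h.lt
  isEndpoint := by
    simp only [IsEndpointFrom, arcFrom_one_cons]
    refine Fin.cases ?_ h.isEndpoint
    rintro ⟨⟨j, arc⟩, -⟩
    exact Nat.not_succ_le_self o arc.1
  exists_ne_zero := by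
    obtain ⟨f, hf, ne_zero⟩ := h.exists_ne_zero
    obtain ⟨r, hr⟩ := exists_ne (0 : R)
    have update_of_lt {i : ℕ} (hi : o + 1 ≤ i) : Function.update f o r i = f i :=
      Function.update_of_ne (by omega) _ _
    refine ⟨Function.update f o r,
      isTailFreeInvariant_one_cons.2 (hf.congr fun i => update_of_lt), Fin.cases ?_ fun k => ?_⟩
    · simpa using hr
    · simpa only [Fin.cons_succ, update_of_lt (h.le k)] using ne_zero k
  eq_zero {f} hf hp {i} hi hi' := by
    obtain rfl | hi := hi.eq_or_lt
    · exact hp 0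
    · exact h.eq_zero (isTailFreeInvariant_one_cons.1 hf) (fun k => hp k.succ) hi hi'

end IsPathSystem

theorem WindsDown.exists_isPathSystem (R : Type*) [AddCommGroup R] [Nontrivial R] {n k s : ℕ}
    {a b cs : List ℕ} (w : WindsDown n a b cs k (List.replicate s 1)) (ones : ∀ c ∈ cs, c = 1)
    (hk : k ≤ s) (ha : a.sum ≤ n) (hb : b.sum ≤ n) :
    ∃ p : Fin cs.length → ℕ, IsPathSystem R n 0 a b p :=
  WindsDown.offset_induction
    (motive := fun o a b q => ∃ p : Fin q → ℕ, IsPathSystem R n o a b p)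
    (fun _ _ h => ⟨_, .replicate_one h⟩) (fun ⟨p, h⟩ => ⟨p, h.swap⟩)
    (fun ⟨p, h⟩ => ⟨p, h.zero_cons⟩) (fun hN ⟨_, h⟩ => ⟨_, h.unwind hN⟩)
    (fun ho ⟨_, h⟩ => ⟨_, h.delete ho⟩) w ones hk ha hb (zero_add n)

/-- The admissible locations of the (type-A) seaweed of `a` and `b` on the indices `o, o + 1, …`. -/
def AdmissibleFrom (o : ℕ) (a b : List ℕ) (i j : ℕ) : Prop :=
  (j ≤ i ∧ SameBlockFrom o a i j) ∨ (i ≤ j ∧ SameBlockFrom o b i j)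

section Admissible

variable {o y z i j : ℕ} {a b : List ℕ}

theorem AdmissibleFrom.swap (h : AdmissibleFrom o a b i j) : AdmissibleFrom o b a j i :=
  h.elim (fun h => .inr ⟨h.1, h.2.2.1, h.2.1, h.2.2.2.symm⟩)
    (fun h => .inl ⟨h.1, h.2.2.1, h.2.1, h.2.2.2.symm⟩)

theorem SameBlock.lt_sum {c : List ℕ} {i j : ℕ} (h : SameBlock c i j) : i < c.sum := by
  induction c generalizing i j with
  | nil => exact h.elim
  | cons d c ih =>
    rw [List.sum_cons]
    rcases h with h | ⟨_, _, h⟩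
    · omega
    · have := ih h
      omega

theorem SameBlockFrom.lt {c : List ℕ} (h : SameBlockFrom o c i j) :
    i < o + c.sum ∧ j < o + c.sum :=
  ⟨by have := h.2.2.lt_sum; omega, by have := h.2.2.symm.lt_sum; omega⟩

theorem Arc.sameBlock {c : List ℕ} {i j : ℕ} (h : Arc c i j) : SameBlock c i j := by
  induction c generalizing i j with
  | nil => exact h
  | cons d c ih =>
    exact h.imp (fun h => ⟨h.1, h.2.1⟩) fun h => ⟨h.1, h.2.1, ih h.2.2⟩

theorem AdmissibleFrom.mem_Ico {N : ℕ} (h : AdmissibleFrom o a b i j) (ha : o + a.sum = N)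
    (hb : o + b.sum = N) : i ∈ Ico o N ∧ j ∈ Ico o N := by
  simp only [Finset.mem_Ico]
  rcases h with ⟨-, h⟩ | ⟨-, h⟩
  · exact ⟨⟨h.1, ha ▸ h.lt.1⟩, h.2.1, ha ▸ h.lt.2⟩
  · exact ⟨⟨h.1, hb ▸ h.lt.1⟩, h.2.1, hb ▸ h.lt.2⟩

theorem DirectedArc.admissibleFrom (h : DirectedArc o a b i j) : AdmissibleFrom o a b i j :=
  h.imp (fun h => ⟨h.1.le, h.2.1, h.2.2.1, h.2.2.2.sameBlock⟩)
    fun h => ⟨h.1.le, h.2.1, h.2.2.1, h.2.2.2.sameBlock⟩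

theorem not_directedArc_mirror (hi : o + y ≤ i) (hi' : i < o + (y + z)) (hj : o + y ≤ j)
    (hm : mirror o (o + (y + z)) i < o + y)
    (h : DirectedArc o ((y + z) :: a) (y :: b) i j) :
    ¬ DirectedArc o ((y + z) :: a) (y :: b) (mirror o (o + (y + z)) i)
      (mirror o (o + (y + z)) j) := by
  rw [directedArc_cons_cons_iff_of_ge hi] at h
  rw [directedArc_cons_cons_iff_of_lt hm]
  simp only [ArcFrom, Mirrored, mirror] at *
  omega

theorem admissibleFrom_zero_cons : AdmissibleFrom o (0 :: a) b i j ↔ AdmissibleFrom o a b i j := by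
  simp only [AdmissibleFrom, sameBlockFrom_zero_cons]

theorem admissibleFrom_cons_cons {x : ℕ} :
    AdmissibleFrom o (x :: a) (y :: b) i j ↔
      (j ≤ i ∧ ((o ≤ j ∧ i < o + x) ∨ SameBlockFrom (o + x) a i j)) ∨
        (i ≤ j ∧ ((o ≤ i ∧ j < o + y) ∨ SameBlockFrom (o + y) b i j)) := by
  rw [AdmissibleFrom, sameBlockFrom_cons, sameBlockFrom_cons]
  grind

theorem admissibleFrom_unwind :
    AdmissibleFrom (o + min y z) ((z - y) :: y :: a) ((y - z) :: b) i j ↔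
      (j ≤ i ∧ ((o + min y z ≤ j ∧ i < o + z) ∨ (o + z ≤ j ∧ i < o + (y + z)) ∨
        SameBlockFrom (o + (y + z)) a i j)) ∨
      (i ≤ j ∧ ((o + min y z ≤ i ∧ j < o + y) ∨ SameBlockFrom (o + y) b i j)) := by
  rw [AdmissibleFrom, sameBlockFrom_cons, sameBlockFrom_cons, sameBlockFrom_cons,
    show o + min y z + (z - y) = o + z by omega, show o + min y z + (y - z) = o + y by omega,
    show o + z + y = o + (y + z) by omega]
  grind

theorem AdmissibleFrom.of_unwind
    (h : AdmissibleFrom (o + min y z) ((z - y) :: y :: a) ((y - z) :: b) i j) (hj : o + y ≤ j) :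
    AdmissibleFrom o ((y + z) :: a) (y :: b) i j := by
  rw [admissibleFrom_unwind] at h
  rw [admissibleFrom_cons_cons]
  grind

theorem AdmissibleFrom.le_left_of_unwind
    (h : AdmissibleFrom (o + min y z) ((z - y) :: y :: a) ((y - z) :: b) i j) (hj : o + y ≤ j) :
    o + y ≤ i := by
  simp only [admissibleFrom_unwind, SameBlockFrom] at h
  omega

theorem AdmissibleFrom.folded_block
    (h : AdmissibleFrom (o + min y z) ((z - y) :: y :: a) ((y - z) :: b) i j) :
    (j ∈ Ico (o + z) (o + (y + z)) → i ∉ Ico (o + z) (o + (y + z)) → i < o + z) ∧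
      (i ∈ Ico (o + z) (o + (y + z)) → j ∉ Ico (o + z) (o + (y + z)) → o + (y + z) ≤ j) := by
  simp only [admissibleFrom_unwind, SameBlockFrom] at h
  simp only [Finset.mem_Ico]
  omega

end Admissible

section Commutator

variable {K : Type*} [Field K]

/-- The entry `(i, j)` of the commutator of `F` and `X`, both restricted to the indices in `s`. -/
def commOn (s : Finset ℕ) (F X : ℕ → ℕ → K) (i j : ℕ) : K :=
  ∑ k ∈ s, (F i k * X k j - X i k * F k j)

/-- The matrix `G`, restricted to the diagonal block on the indices in `t`. -/
def blockOf (t : Finset ℕ) (G : ℕ → ℕ → K) (i j : ℕ) : K :=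
  if i ∈ t ∧ j ∈ t then G i j else 0

variable {s t : Finset ℕ} {F G X Y : ℕ → ℕ → K} {i j : ℕ}

theorem blockOf_ne_zero_iff : blockOf t G i j ≠ 0 ↔ i ∈ t ∧ j ∈ t ∧ G i j ≠ 0 := by
  rw [blockOf, ite_ne_right_iff, and_assoc]

theorem commOn_transpose :
    commOn s (fun i j => F j i) (fun i j => X j i) i j = -commOn s F X j i := by
  simp only [commOn, ← Finset.sum_neg_distrib]
  exact Finset.sum_congr rfl fun k _ => by ring

theorem commOn_add_left : commOn s (F + G) X i j = commOn s F X i j + commOn s G X i j := by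
  simp only [commOn, ← Finset.sum_add_distrib, Pi.add_apply]
  exact Finset.sum_congr rfl fun k _ => by ring

theorem commOn_congr_right (hi : i ∈ s) (hj : j ∈ s) (h : ∀ p ∈ s, ∀ q ∈ s, X p q = Y p q) :
    commOn s F X i j = commOn s F Y i j :=
  Finset.sum_congr rfl fun k hk => by rw [h k hk j hj, h i hi k hk]

theorem commOn_Ico {l m n : ℕ} (hlm : l ≤ m) (hmn : m ≤ n) :
    commOn (Ico l n) F X i j = commOn (Ico l m) F X i j + commOn (Ico m n) F X i j :=
  (Finset.sum_Ico_consecutive _ hlm hmn).symm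

theorem commOn_of_diagonal (hX : ∀ p ∈ s, ∀ q ∈ s, p ≠ q → X p q = 0) (hi : i ∈ s) (hj : j ∈ s) :
    commOn s F X i j = F i j * (X j j - X i i) := by
  rw [commOn, Finset.sum_sub_distrib, Finset.sum_eq_single j, Finset.sum_eq_single i]
  · ring
  · intro k hk hki
    rw [hX i hi k hk hki.symm, zero_mul]
  · exact fun h => absurd hi h
  · intro k hk hkj
    rw [hX k hk j hj hkj, mul_zero]
  · exact fun h => absurd hj h

theorem commOn_blockOf (hts : t ⊆ s) (col : i ∈ t → j ∉ t → ∀ k ∈ t, X k j = 0)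
    (row : j ∈ t → i ∉ t → ∀ k ∈ t, X i k = 0) :
    commOn s (blockOf t G) X i j = if i ∈ t ∧ j ∈ t then commOn t G X i j else 0 := by
  have restrict : commOn s (blockOf t G) X i j = commOn t (blockOf t G) X i j := by
    refine (Finset.sum_subset hts fun k _ hk => ?_).symm
    simp only [blockOf, hk, false_and, and_false, if_false, zero_mul, mul_zero, sub_zero]
  rw [restrict]
  split_ifs with h
  · exact Finset.sum_congr rfl fun k hk => by simp only [blockOf, h, hk, and_self, if_true]
  · refine Finset.sum_eq_zero fun k hk => ?_
    by_cases hi : i ∈ t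
    · have hj : j ∉ t := fun hj => h ⟨hi, hj⟩
      simp only [blockOf, hj, and_false, if_false, mul_zero, col hi hj k hk, sub_zero]
    · by_cases hj : j ∈ t
      · simp only [blockOf, hi, false_and, if_false, zero_mul, row hj hi k hk, sub_zero]
      · simp only [blockOf, hi, hj, false_and, and_false, if_false, zero_mul, mul_zero, sub_zero]

end Commutator

/-- `F` represents, under the trace form, a one-form on the seaweed of `a` and `b` on the indices
`o, …, N - 1` whose off-diagonal part is supported on the directed arcs of the meander.  The
grading excludes cycles. -/
structure IsMeanderForm {K : Type*} [Field K] (N o : ℕ) (a b : List ℕ) (F : ℕ → ℕ → K) :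
    Prop where
  sum_top : o + a.sum = N
  sum_bottom : o + b.sum = N
  exists_grading : ∃ g : ℕ → ℤ, IsGraded o 2 a b g
  ne_zero_iff {i j : ℕ} (hij : i ≠ j) : F j i ≠ 0 ↔ DirectedArc o a b i j

/-- `X` lies in the seaweed of `a` and `b`, up to its diagonal, and in the kernel of the Kirillov
form of the one-form represented by `F`. -/
structure InMeanderKernel {K : Type*} [Field K] (N o : ℕ) (a b : List ℕ) (F X : ℕ → ℕ → K) :
    Prop where
  admissible {i j : ℕ} (hij : i ≠ j) (hX : X i j ≠ 0) : AdmissibleFrom o a b i j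
  comm {i j : ℕ} (h : AdmissibleFrom o a b i j) : commOn (Ico o N) F X j i = 0

/-- `X` is diagonal on the indices `o, …, N - 1`, and constant along the arcs of the meander. -/
structure IsDiagonalAlong {K : Type*} [Field K] (N o : ℕ) (a b : List ℕ) (X : ℕ → ℕ → K) :
    Prop where
  diagonal : ∀ i ∈ Ico o N, ∀ j ∈ Ico o N, i ≠ j → X i j = 0
  isGraded : IsGraded o 0 a b fun i => X i i

theorem IsMeanderForm.commOn_eq_zero {K : Type*} [Field K] {N o : ℕ} {a b : List ℕ}
    {F X : ℕ → ℕ → K} (hF : IsMeanderForm N o a b F) (graded : IsGraded o 0 a b fun p => X p p)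
    {s : Finset ℕ} (diagonal : ∀ p ∈ s, ∀ q ∈ s, p ≠ q → X p q = 0) {i j : ℕ} (hi : i ∈ s)
    (hj : j ∈ s) : commOn s F X j i = 0 := by
  rw [commOn_of_diagonal diagonal hj hi]
  by_cases hij : i = j
  · rw [hij, sub_self, mul_zero]
  · by_cases hFji : F j i = 0
    · rw [hFji, zero_mul]
    · have eq : X j j = X i i + 0 := graded ((hF.ne_zero_iff hij).1 hFji)
      rw [eq, add_zero, sub_self, mul_zero]

section Fold

variable {K : Type*} [Field K] {N o y z : ℕ} {a b : List ℕ} {F G X : ℕ → ℕ → K}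

/-- The entry of `F` on the arc from `p` to its mirror image, for a vertex `p` that is not in the
folded block. -/
def foldWeight (o y z : ℕ) (F : ℕ → ℕ → K) (p : ℕ) : K :=
  if o + y ≤ p then F (mirror o (o + (y + z)) p) p else 1

/-- The diagonal block of `G` on the folded indices `[o, o + y)`, moved to their mirror images
`[o + z, o + (y + z))` and conjugated by the weights of the arcs. -/
def foldBlock (o y z : ℕ) (F G : ℕ → ℕ → K) (p q : ℕ) : K :=
  (foldWeight o y z F p)⁻¹ * G (mirror o (o + (y + z)) p) (mirror o (o + (y + z)) q) *
    foldWeight o y z F q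

/-- The form on the wound-down meander that is induced by `F`. -/
def foldForm (N o y z : ℕ) (F : ℕ → ℕ → K) : ℕ → ℕ → K :=
  blockOf (Ico (o + y) N) F + blockOf (Ico (o + z) (o + (y + z))) (foldBlock o y z F F)

/-- The matrix on the indices of the wound-down meander that is induced by `X`. -/
def foldMatrix (N o y z : ℕ) (F X : ℕ → ℕ → K) (p q : ℕ) : K :=
  if p ∈ Ico (o + y) N ∧ q ∈ Ico (o + y) N then X p q
  else blockOf (Ico (o + z) (o + (y + z))) (foldBlock o y z F X) p q

theorem foldMatrix_of_kept {i j : ℕ} (hi : i ∈ Ico (o + y) N) (hj : j ∈ Ico (o + y) N) :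
    foldMatrix N o y z F X i j = X i j :=
  if_pos ⟨hi, hj⟩

theorem commOn_foldBlock (hw : ∀ p ∈ Ico (o + z) (o + (y + z)), foldWeight o y z F p ≠ 0)
    (i j : ℕ) :
    commOn (Ico (o + z) (o + (y + z))) (foldBlock o y z F G) (foldBlock o y z F X) i j =
      (foldWeight o y z F i)⁻¹ *
        commOn (Ico o (o + y)) G X (mirror o (o + (y + z)) i) (mirror o (o + (y + z)) j) *
        foldWeight o y z F j := by
  rw [commOn, commOn, Finset.mul_sum, Finset.sum_mul]
  refine Finset.sum_nbij' (mirror o (o + (y + z))) (mirror o (o + (y + z))) ?_ ?_ ?_ ?_ ?_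
  · intro k hk; simp only [mem_Ico, mirror] at *; omega
  · intro k hk; simp only [mem_Ico, mirror] at *; omega
  · intro k hk; simp only [mem_Ico, mirror] at *; omega
  · intro k hk; simp only [mem_Ico, mirror] at *; omega
  · intro k hk
    have cancel := mul_inv_cancel₀ (hw k hk)
    unfold foldBlock
    linear_combination (foldWeight o y z F i)⁻¹ * foldWeight o y z F j *
      (G (mirror o (o + (y + z)) i) (mirror o (o + (y + z)) k) *
        X (mirror o (o + (y + z)) k) (mirror o (o + (y + z)) j) -
       X (mirror o (o + (y + z)) i) (mirror o (o + (y + z)) k) *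
        G (mirror o (o + (y + z)) k) (mirror o (o + (y + z)) j)) * cancel

namespace IsMeanderForm

variable (hF : IsMeanderForm N o ((y + z) :: a) (y :: b) F)
include hF

theorem unwind_le : o + (y + z) ≤ N := by
  have := hF.sum_top
  rw [List.sum_cons] at this
  omega

theorem apply_eq_zero {i j : ℕ} (hj : j < o + y) (hi : o + y ≤ i)
    (hij : ¬ (i < o + (y + z) ∧ j = mirror o (o + (y + z)) i)) : F j i = 0 := by
  by_contra h
  have := ((hF.ne_zero_iff (by omega)).1 h).sides_of_cons_cons
  omega

theorem foldWeight_ne_zero {p : ℕ} (hp : p ∈ Ico (o + z) (o + (y + z))) :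
    foldWeight o y z F p ≠ 0 := by
  rw [mem_Ico] at hp
  unfold foldWeight
  split_ifs with hy
  · have lt : mirror o (o + (y + z)) p < p := by unfold mirror; omega
    refine (hF.ne_zero_iff lt.ne').2 (.inl ⟨lt, arcFrom_cons.2 (.inl ?_)⟩)
    unfold Mirrored
    unfold mirror at *
    omega
  · exact one_ne_zero

theorem foldForm_ne_zero_iff {i j : ℕ} (hij : i ≠ j) :
    foldForm N o y z F j i ≠ 0 ↔
      DirectedArc (o + min y z) ((z - y) :: y :: a) ((y - z) :: b) i j := by
  have kept : blockOf (Ico (o + y) N) F j i ≠ 0 ↔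
      o + y ≤ i ∧ o + y ≤ j ∧ DirectedArc o ((y + z) :: a) (y :: b) i j := by
    rw [blockOf_ne_zero_iff, hF.ne_zero_iff hij]
    constructor
    · rintro ⟨hj, hi, arc⟩
      exact ⟨(mem_Ico.1 hi).1, (mem_Ico.1 hj).1, arc⟩
    · rintro ⟨hi, hj, arc⟩
      have ⟨hi', hj'⟩ := arc.admissibleFrom.mem_Ico hF.sum_top hF.sum_bottom
      exact ⟨mem_Ico.2 ⟨hj, (mem_Ico.1 hj').2⟩, mem_Ico.2 ⟨hi, (mem_Ico.1 hi').2⟩, arc⟩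
  have folded : blockOf (Ico (o + z) (o + (y + z))) (foldBlock o y z F F) j i ≠ 0 ↔
      (o + z ≤ i ∧ i < o + (y + z)) ∧ (o + z ≤ j ∧ j < o + (y + z)) ∧
        DirectedArc o ((y + z) :: a) (y :: b) (mirror o (o + (y + z)) i)
          (mirror o (o + (y + z)) j) := by
    rw [blockOf_ne_zero_iff, mem_Ico, mem_Ico, and_left_comm]
    refine and_congr_right fun hi => and_congr_right fun hj => ?_
    rw [foldBlock, mul_ne_zero_iff, mul_ne_zero_iff,
      and_iff_left (hF.foldWeight_ne_zero (mem_Ico.2 hi)),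
      and_iff_right (inv_ne_zero (hF.foldWeight_ne_zero (mem_Ico.2 hj))), hF.ne_zero_iff]
    unfold mirror
    omega
  rw [directedArc_unwind_iff, ← kept, ← folded, foldForm, Pi.add_apply, Pi.add_apply]
  by_cases hk : blockOf (Ico (o + y) N) F j i = 0
  · simp only [hk, zero_add, ne_eq, not_true_eq_false, false_or]
  · have hf : blockOf (Ico (o + z) (o + (y + z))) (foldBlock o y z F F) j i = 0 := by
      by_contra hf
      obtain ⟨hi, hj, arc⟩ := kept.1 hk
      obtain ⟨hi', -, arc'⟩ := folded.1 hf
      exact not_directedArc_mirror hi hi'.2 hj (by unfold mirror; omega) arc arc'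
    simp only [hf, add_zero, ne_eq, not_true_eq_false, or_false]

theorem fold : IsMeanderForm N (o + min y z) ((z - y) :: y :: a) ((y - z) :: b)
    (foldForm N o y z F) where
  sum_top := by have := hF.sum_top; simp only [List.sum_cons] at *; omega
  sum_bottom := by have := hF.sum_bottom; simp only [List.sum_cons] at *; omega
  exists_grading := hF.exists_grading.imp' _ fun _ => IsGraded.wind
  ne_zero_iff := hF.foldForm_ne_zero_iff

end IsMeanderForm
end Fold

namespace InMeanderKernel

variable {K : Type*} [Field K] {N o y z i j : ℕ} {a b : List ℕ} {F X : ℕ → ℕ → K}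
  (hX : InMeanderKernel N o ((y + z) :: a) (y :: b) F X)

section
include hX

theorem eq_zero_of_lt (hi : i < o + y) (hj : o + y ≤ j) : X i j = 0 := by
  by_contra h
  have := hX.admissible (by omega) h
  simp only [admissibleFrom_cons_cons, SameBlockFrom] at this
  omega

variable (hF : IsMeanderForm N o ((y + z) :: a) (y :: b) F)
include hF

theorem commOn_folded (hi : o + y ≤ i) (j : ℕ) :
    commOn (Ico o (o + y)) F X j i =
      -if i ∈ Ico (o + z) (o + (y + z)) then
        X j (mirror o (o + (y + z)) i) * F (mirror o (o + (y + z)) i) i else 0 := by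
  have upper_zero {k : ℕ} (hk : k ∈ Ico o (o + y)) : X k i = 0 :=
    hX.eq_zero_of_lt (mem_Ico.1 hk).2 hi
  split_ifs with hC <;> simp only [mem_Ico] at hC
  · rw [commOn, Finset.sum_eq_single (mirror o (o + (y + z)) i)]
    · rw [upper_zero (by simp only [mem_Ico, mirror]; omega), mul_zero, zero_sub]
    · intro k hk hki
      rw [upper_zero hk, hF.apply_eq_zero (mem_Ico.1 hk).2 hi (by omega), mul_zero, mul_zero,
        sub_zero]
    · exact fun h => (h (by simp only [mem_Ico, mirror]; omega)).elim
  · rw [neg_zero]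
    refine Finset.sum_eq_zero fun k hk => ?_
    rw [upper_zero hk, hF.apply_eq_zero (mem_Ico.1 hk).2 hi, mul_zero, mul_zero, sub_zero]
    unfold mirror
    rw [mem_Ico] at hk
    omega

theorem commOn_kept (hj : o ≤ j) (hj' : j < o + y) (i : ℕ) :
    commOn (Ico (o + y) N) F X j i =
      if o + y ≤ mirror o (o + (y + z)) j then
        F j (mirror o (o + (y + z)) j) * X (mirror o (o + (y + z)) j) i else 0 := by
  have upper_zero {k : ℕ} (hk : k ∈ Ico (o + y) N) : X j k = 0 :=
    hX.eq_zero_of_lt hj' (mem_Ico.1 hk).1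
  have form_zero {k : ℕ} (hk : k ∈ Ico (o + y) N) (hkj : k ≠ mirror o (o + (y + z)) j) :
      F j k = 0 :=
    hF.apply_eq_zero hj' (mem_Ico.1 hk).1 (by unfold mirror at *; omega)
  split_ifs with hm
  · have mem : mirror o (o + (y + z)) j ∈ Ico (o + y) N :=
      mem_Ico.2 ⟨hm, by have := hF.unwind_le; unfold mirror; omega⟩
    rw [commOn, Finset.sum_eq_single (mirror o (o + (y + z)) j)]
    · rw [upper_zero mem, zero_mul, sub_zero]
    · intro k hk hkj
      rw [upper_zero hk, form_zero hk hkj, zero_mul, zero_mul, sub_zero]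
    · exact fun h => (h mem).elim
  · refine Finset.sum_eq_zero fun k hk => ?_
    rw [upper_zero hk, form_zero hk fun h => hm (h ▸ (mem_Ico.1 hk).1), zero_mul, zero_mul,
      sub_zero]

theorem commOn_folded_add_kept (h : AdmissibleFrom o ((y + z) :: a) (y :: b) i j) :
    commOn (Ico o (o + y)) F X j i + commOn (Ico (o + y) N) F X j i = 0 := by
  rw [← commOn_Ico (by omega) (by have := hF.unwind_le; omega), hX.comm h]

theorem commOn_kept_of_ge (hi : o + y ≤ i) (h : AdmissibleFrom o ((y + z) :: a) (y :: b) i j) :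
    commOn (Ico (o + y) N) F X j i =
      if i ∈ Ico (o + z) (o + (y + z)) then
        X j (mirror o (o + (y + z)) i) * F (mirror o (o + (y + z)) i) i else 0 := by
  have := hX.commOn_folded_add_kept hF h
  rwa [hX.commOn_folded hF hi, neg_add_eq_zero, eq_comm] at this

theorem commOn_folded_of_lt (hi : o ≤ i) (hi' : i < o + y) (hj : o ≤ j) (hj' : j < o + y) :
    commOn (Ico o (o + y)) F X j i =
      -if o + y ≤ mirror o (o + (y + z)) j then
        F j (mirror o (o + (y + z)) j) * X (mirror o (o + (y + z)) j) i else 0 := by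
  have := hX.commOn_folded_add_kept hF (i := i) (j := j) (by
    rw [admissibleFrom_cons_cons]
    omega)
  rwa [hX.commOn_kept hF hj hj', add_eq_zero_iff_eq_neg] at this

theorem cross_eq (hj : o ≤ j) (hj' : j < o + y) (hi : o + y ≤ i) (hi' : i < o + (y + z)) :
    (if i ∈ Ico (o + z) (o + (y + z)) then
      X j (mirror o (o + (y + z)) i) * F (mirror o (o + (y + z)) i) i else 0) =
    if o + y ≤ mirror o (o + (y + z)) j then
      F j (mirror o (o + (y + z)) j) * X (mirror o (o + (y + z)) j) i else 0 := by
  rw [← hX.commOn_kept_of_ge hF hi (by rw [admissibleFrom_cons_cons]; omega),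
    hX.commOn_kept hF hj hj']

theorem eq_zero_of_lt_folded (hi : o + z ≤ i) (hi' : i < o + (y + z)) (hiy : o + y ≤ i)
    (hj : o + y ≤ j) (hjz : j < o + z) : X i j = 0 := by
  have cross := hX.cross_eq hF (i := j) (j := mirror o (o + (y + z)) i)
    (by unfold mirror; omega) (by unfold mirror; omega) hj (by omega)
  rw [if_neg (by rw [mem_Ico]; omega), mirror_mirror (by omega) hi', if_pos hiy] at cross
  have ne := hF.foldWeight_ne_zero (mem_Ico.2 ⟨hi, hi'⟩)
  rw [foldWeight, if_pos hiy] at ne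
  exact (mul_eq_zero.1 cross.symm).resolve_left ne

theorem foldBlock_eq_zero (hi : o + z ≤ i) (hi' : i < o + y) (hj : o + y ≤ j)
    (hj' : j < o + (y + z)) : foldBlock o y z F X i j = 0 := by
  have cross := hX.cross_eq hF (i := j) (j := mirror o (o + (y + z)) i)
    (by unfold mirror; omega) (by unfold mirror; omega) hj hj'
  rw [if_pos (by rw [mem_Ico]; omega), mirror_mirror (by omega) (by omega),
    if_neg hi'.not_ge] at cross
  rw [foldBlock, mul_assoc, foldWeight, foldWeight, if_pos hj, cross, mul_zero]

theorem foldBlock_eq_self (hi : o + y ≤ i) (hi' : i ∈ Ico (o + z) (o + (y + z)))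
    (hj : o + y ≤ j) (hj' : j ∈ Ico (o + z) (o + (y + z))) : foldBlock o y z F X i j = X i j := by
  have ne := hF.foldWeight_ne_zero hi'
  have hiC := mem_Ico.1 hi'
  have cross := hX.cross_eq hF (i := j) (j := mirror o (o + (y + z)) i)
    (by unfold mirror; omega) (by unfold mirror; omega) hj (mem_Ico.1 hj').2
  rw [if_pos hj', mirror_mirror (by omega) (by omega), if_pos hi] at cross
  rw [foldWeight, if_pos hi] at ne
  rw [foldBlock, mul_assoc, foldWeight, foldWeight, if_pos hi, if_pos hj, cross,
    inv_mul_cancel_left₀ ne]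

theorem foldMatrix_of_folded (hi : i ∈ Ico (o + z) (o + (y + z)))
    (hj : j ∈ Ico (o + z) (o + (y + z))) :
    foldMatrix N o y z F X i j = foldBlock o y z F X i j := by
  unfold foldMatrix
  split_ifs with h
  · exact (hX.foldBlock_eq_self hF (mem_Ico.1 h.1).1 hi (mem_Ico.1 h.2).1 hj).symm
  · exact if_pos ⟨hi, hj⟩

theorem admissible_of_foldMatrix_ne_zero (hij : i ≠ j) (h : foldMatrix N o y z F X i j ≠ 0) :
    AdmissibleFrom (o + min y z) ((z - y) :: y :: a) ((y - z) :: b) i j := by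
  rw [admissibleFrom_unwind]
  unfold foldMatrix at h
  split_ifs at h with hkept <;> simp only [mem_Ico] at hkept
  · have not_below_fold := mt fun h' => hX.eq_zero_of_lt_folded hF (i := i) (j := j) h'
    have adm := hX.admissible hij h
    simp only [admissibleFrom_cons_cons, SameBlockFrom] at adm ⊢
    grind
  · obtain ⟨hi, hj, h⟩ := blockOf_ne_zero_iff.1 h
    have := hF.unwind_le
    have not_beyond : ¬ (i < o + y ∧ o + y ≤ j) := fun hy =>
      h (hX.foldBlock_eq_zero hF (mem_Ico.1 hi).1 hy.1 hy.2 (mem_Ico.1 hj).2)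
    simp only [mem_Ico] at hi hj
    omega

end
end InMeanderKernel

namespace InMeanderKernel

variable {K : Type*} [Field K] {N o y z i j : ℕ} {a b : List ℕ} {F X : ℕ → ℕ → K}
  (hX : InMeanderKernel N o ((y + z) :: a) (y :: b) F X)
include hX

theorem eq_zero_of_beyond (hi : o + (y + z) ≤ i) (hj : j < o + y) : X i j = 0 := by
  by_contra h
  have := hX.admissible (by omega) h
  simp only [admissibleFrom_cons_cons, SameBlockFrom] at this
  omega

variable (hF : IsMeanderForm N o ((y + z) :: a) (y :: b) F)
include hF

theorem commOn_foldForm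
    (h : AdmissibleFrom (o + min y z) ((z - y) :: y :: a) ((y - z) :: b) i j) :
    commOn (Ico (o + min y z) N) (foldForm N o y z F) (foldMatrix N o y z F X) j i =
      (if j ∈ Ico (o + y) N ∧ i ∈ Ico (o + y) N then
        commOn (Ico (o + y) N) F (foldMatrix N o y z F X) j i else 0) +
      if j ∈ Ico (o + z) (o + (y + z)) ∧ i ∈ Ico (o + z) (o + (y + z)) then
        commOn (Ico (o + z) (o + (y + z))) (foldBlock o y z F F) (foldMatrix N o y z F X) j i
      else 0 := by
  have mem_top := h.mem_Ico hF.fold.sum_top hF.fold.sum_bottom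
  have le := hF.unwind_le
  rw [foldForm, commOn_add_left, commOn_blockOf, commOn_blockOf]
  · exact Finset.Ico_subset_Ico (by omega) le
  · intro hj hi k hk
    by_contra hne
    have := (hX.admissible_of_foldMatrix_ne_zero hF (ne_of_mem_of_not_mem hk hi) hne).folded_block.2
      hk hi
    have := h.folded_block.1 hj hi
    omega
  · intro hi hj k hk
    by_contra hne
    have := (hX.admissible_of_foldMatrix_ne_zero hF (ne_of_mem_of_not_mem hk hj).symm
      hne).folded_block.1 hk hj
    have := h.folded_block.2 hi hj
    omega
  · exact Finset.Ico_subset_Ico (by omega) le_rfl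
  · intro hj hi
    exact (hi (mem_Ico.2 ⟨h.le_left_of_unwind (mem_Ico.1 hj).1, (mem_Ico.1 mem_top.1).2⟩)).elim
  · intro _ hj k hk
    by_contra hne
    have := (hX.admissible_of_foldMatrix_ne_zero hF (ne_of_mem_of_not_mem hk hj).symm
      hne).le_left_of_unwind (mem_Ico.1 hk).1
    exact hj (mem_Ico.2 ⟨this, (mem_Ico.1 mem_top.2).2⟩)

theorem commOn_foldForm_folded (hi : i ∈ Ico (o + z) (o + (y + z)))
    (hj : j ∈ Ico (o + z) (o + (y + z))) :
    commOn (Ico (o + z) (o + (y + z))) (foldBlock o y z F F) (foldMatrix N o y z F X) j i =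
      -if o + y ≤ j then X j (mirror o (o + (y + z)) i) * foldWeight o y z F i else 0 := by
  have ne := hF.foldWeight_ne_zero hj
  rw [commOn_congr_right hj hi fun p hp q hq => hX.foldMatrix_of_folded hF hp hq,
    commOn_foldBlock fun p => hF.foldWeight_ne_zero]
  rw [mem_Ico] at hi hj
  rw [hX.commOn_folded_of_lt hF, mirror_mirror (by omega) hj.2]
  · split_ifs with hy
    · rw [foldWeight, if_pos hy] at ne ⊢
      field_simp
    · rw [neg_zero, mul_zero, zero_mul]
  all_goals unfold mirror; omega

theorem fold :
    InMeanderKernel N (o + min y z) ((z - y) :: y :: a) ((y - z) :: b) (foldForm N o y z F)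
      (foldMatrix N o y z F X) where
  admissible hij h := hX.admissible_of_foldMatrix_ne_zero hF hij h
  comm {i j} h := by
    rw [hX.commOn_foldForm hF h]
    have mem := h.mem_Ico hF.fold.sum_top hF.fold.sum_bottom
    simp only [mem_Ico] at mem
    by_cases hj : o + y ≤ j
    · have hi := h.le_left_of_unwind hj
      have hjR : j ∈ Ico (o + y) N := mem_Ico.2 ⟨hj, mem.2.2⟩
      have hiR : i ∈ Ico (o + y) N := mem_Ico.2 ⟨hi, mem.1.2⟩
      rw [if_pos ⟨hjR, hiR⟩, commOn_congr_right hjR hiR fun p hp q hq => foldMatrix_of_kept hp hq,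
        hX.commOn_kept_of_ge hF hi (h.of_unwind hj)]
      by_cases hiC : i ∈ Ico (o + z) (o + (y + z))
      · by_cases hjC : j ∈ Ico (o + z) (o + (y + z))
        · rw [if_pos hiC, if_pos ⟨hjC, hiC⟩, hX.commOn_foldForm_folded hF hiC hjC, if_pos hj,
            foldWeight, if_pos hi, add_neg_cancel]
        · rw [if_pos hiC, if_neg fun h => hjC h.1, add_zero,
            hX.eq_zero_of_beyond (h.folded_block.2 hiC hjC), zero_mul]
          rw [mem_Ico] at hiC
          unfold mirror
          omega
      · rw [if_neg hiC, if_neg fun h => hiC h.2, add_zero]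
    · rw [if_neg fun h => hj (mem_Ico.1 h.1).1, zero_add]
      split_ifs with hC
      · rw [hX.commOn_foldForm_folded hF hC.2 hC.1, if_neg hj, neg_zero]
      · rfl

theorem foldMatrix_mirror (hi : i ∈ Ico o (o + y)) (hj : j ∈ Ico o (o + y)) :
    foldMatrix N o y z F X (mirror o (o + (y + z)) i) (mirror o (o + (y + z)) j) =
      (foldWeight o y z F (mirror o (o + (y + z)) i))⁻¹ * X i j *
        foldWeight o y z F (mirror o (o + (y + z)) j) := by
  rw [mem_Ico] at hi hj
  rw [hX.foldMatrix_of_folded hF, foldBlock, mirror_mirror hi.1 (by omega),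
    mirror_mirror hj.1 (by omega)]
  all_goals rw [mem_Ico]; unfold mirror; omega

theorem isGraded_of_fold
    (h : IsGraded (o + min y z) 0 ((z - y) :: y :: a) ((y - z) :: b)
      fun p => foldMatrix N o y z F X p p) :
    IsGraded o 0 ((y + z) :: a) (y :: b) fun p => X p p := by
  have value {p : ℕ} (hp : p ∈ Ico o N) :
      (if o + y ≤ p then foldMatrix N o y z F X p p else
        foldMatrix N o y z F X (mirror o (o + (y + z)) p) (mirror o (o + (y + z)) p) + 0) =
      X p p := by
    rw [mem_Ico] at hp
    split_ifs with hy
    · exact foldMatrix_of_kept (mem_Ico.2 ⟨hy, hp.2⟩) (mem_Ico.2 ⟨hy, hp.2⟩)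
    · have ne := hF.foldWeight_ne_zero (p := mirror o (o + (y + z)) p) (by
        rw [mem_Ico]; unfold mirror; omega)
      rw [add_zero, hX.foldMatrix_mirror hF (by rw [mem_Ico]; omega) (by rw [mem_Ico]; omega),
        mul_right_comm, inv_mul_cancel₀ ne, one_mul]
  intro i j arc
  have mem := arc.admissibleFrom.mem_Ico hF.sum_top hF.sum_bottom
  simpa only [value mem.1, value mem.2] using h.unwind arc

theorem cross_eq_zero (graded : IsGraded o 0 ((y + z) :: a) (y :: b) fun p => X p p)
    (kept : ∀ p ∈ Ico (o + y) N, ∀ q ∈ Ico (o + y) N, p ≠ q → X p q = 0)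
    (folded : ∀ p ∈ Ico o (o + y), ∀ q ∈ Ico o (o + y), p ≠ q → X p q = 0)
    (hi : i ∈ Ico (o + y) N) (hj : j ∈ Ico o (o + y)) : X i j = 0 := by
  have le := hF.unwind_le
  have hi' := mem_Ico.1 hi
  have hj' := mem_Ico.1 hj
  by_cases hix : o + (y + z) ≤ i
  · exact hX.eq_zero_of_beyond hix hj'.2
  by_cases hiz : o + z ≤ i
  · have hmi : mirror o (o + (y + z)) i ∈ Ico o (o + y) := by rw [mem_Ico]; unfold mirror; omega
    have comm := hX.commOn_folded_of_lt hF (mem_Ico.1 hj).1 (mem_Ico.1 hj).2 (mem_Ico.1 hmi).1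
      (mem_Ico.1 hmi).2
    have ne := hF.foldWeight_ne_zero (mem_Ico.2 ⟨hiz, not_le.1 hix⟩)
    rw [hF.commOn_eq_zero graded folded hj hmi, mirror_mirror (by omega) (by omega),
      if_pos hi'.1, eq_comm, neg_eq_zero] at comm
    rw [foldWeight, if_pos hi'.1] at ne
    exact (mul_eq_zero.1 comm).resolve_left ne
  · have hmj : mirror o (o + (y + z)) j ∈ Ico (o + z) (o + (y + z)) := by
      rw [mem_Ico]; unfold mirror; omega
    have hmj' := mem_Ico.1 hmj
    have comm := hX.commOn_kept_of_ge hF (i := mirror o (o + (y + z)) j) (j := i) (by omega) (by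
      rw [admissibleFrom_cons_cons]; omega)
    have ne := hF.foldWeight_ne_zero hmj
    rw [hF.commOn_eq_zero graded kept (mem_Ico.2 (by omega)) hi, if_pos hmj,
      mirror_mirror hj'.1 (by omega), eq_comm] at comm
    rw [foldWeight, if_pos (by omega), mirror_mirror hj'.1 (by omega)] at ne
    exact (mul_eq_zero.1 comm).resolve_right ne

theorem isDiagonalAlong_of_fold
    (h : IsDiagonalAlong N (o + min y z) ((z - y) :: y :: a) ((y - z) :: b)
      (foldMatrix N o y z F X)) : IsDiagonalAlong N o ((y + z) :: a) (y :: b) X := by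
  have le := hF.unwind_le
  have graded := hX.isGraded_of_fold hF h.isGraded
  have kept (i) (hi : i ∈ Ico (o + y) N) (j) (hj : j ∈ Ico (o + y) N) (hij : i ≠ j) :
      X i j = 0 := by
    rw [← foldMatrix_of_kept (z := z) (F := F) (X := X) hi hj]
    rw [mem_Ico] at hi hj
    exact h.diagonal i (by rw [mem_Ico]; omega) j (by rw [mem_Ico]; omega) hij
  have folded (i) (hi : i ∈ Ico o (o + y)) (j) (hj : j ∈ Ico o (o + y)) (hij : i ≠ j) :
      X i j = 0 := by
    have zero := h.diagonal (mirror o (o + (y + z)) i)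
      (by rw [mem_Ico] at *; unfold mirror; omega) (mirror o (o + (y + z)) j)
      (by rw [mem_Ico] at *; unfold mirror; omega)
      (by rw [mem_Ico] at *; unfold mirror; omega)
    rw [hX.foldMatrix_mirror hF hi hj] at zero
    refine (mul_eq_zero.1 ((mul_eq_zero.1 zero).resolve_right ?_)).resolve_left (inv_ne_zero ?_)
    all_goals
      refine hF.foldWeight_ne_zero ?_
      rw [mem_Ico] at *
      unfold mirror
      omega
  refine ⟨fun i hi j hj hij => ?_, graded⟩
  rw [mem_Ico] at hi hj
  rcases lt_or_ge i (o + y) with hiy | hiy <;> rcases lt_or_ge j (o + y) with hjy | hjy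
  · exact folded i (mem_Ico.2 ⟨hi.1, hiy⟩) j (mem_Ico.2 ⟨hj.1, hjy⟩) hij
  · exact hX.eq_zero_of_lt hiy hjy
  · exact hX.cross_eq_zero hF graded kept folded (mem_Ico.2 ⟨hiy, hi.2⟩) (mem_Ico.2 ⟨hj.1, hjy⟩)
  · exact kept i (mem_Ico.2 ⟨hiy, hi.2⟩) j (mem_Ico.2 ⟨hjy, hj.2⟩) hij

end InMeanderKernel

theorem meander_induction {N : ℕ} {motive : ℕ → List ℕ → List ℕ → Prop}
    (nil : motive N [] [])
    (swap : ∀ {o a b}, motive o b a → motive o a b)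
    (zero_cons : ∀ {o a b}, motive o a b → motive o (0 :: a) b)
    (delete : ∀ {o y a b}, 0 < y → motive (o + y) a b → motive o (y :: a) (y :: b))
    (unwind : ∀ {o y z a b}, 0 < y → 0 < z →
      motive (o + min y z) ((z - y) :: y :: a) ((y - z) :: b) → motive o ((y + z) :: a) (y :: b))
    (o : ℕ) (a b : List ℕ) (ha : o + a.sum = N) (hb : o + b.sum = N) : motive o a b := by
  induction hm : 2 * (N - o) + a.length + b.length using Nat.strong_induction_on
    generalizing o a b with
  | _ m ih
  have longer {o x y a b} (hy : 0 < y) (hxy : y < x) (ha : o + (x :: a).sum = N)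
      (hb : o + (y :: b).sum = N) (hm : 2 * (N - o) + (x :: a).length + (y :: b).length = m) :
      motive o (x :: a) (y :: b) := by
    obtain ⟨z, rfl⟩ := Nat.exists_eq_add_of_le hxy.le
    simp only [List.sum_cons, List.length_cons] at ha hb hm
    refine unwind hy (by omega) (ih _ ?_ _ _ _ ?_ ?_ rfl) <;>
      simp only [List.sum_cons, List.length_cons] <;> omega
  have leading_zero {o a b} (ha : o + a.sum = N) (hb : o + b.sum = N)
      (hm : 2 * (N - o) + (a.length + 1) + b.length = m) : motive o (0 :: a) b :=
    zero_cons (ih _ (by omega) o a b ha hb rfl)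
  rcases a with - | ⟨x, a⟩ <;> rcases b with - | ⟨y, b⟩ <;>
    simp only [List.sum_cons, List.sum_nil, List.length_cons, List.length_nil] at ha hb hm
  · obtain rfl : o = N := ha
    exact nil
  · obtain rfl : y = 0 := by omega
    exact swap (leading_zero (by omega) ha (by rw [List.length_nil]; omega))
  · obtain rfl : x = 0 := by omega
    exact leading_zero (by omega) hb (by rw [List.length_nil]; omega)
  rcases Nat.eq_zero_or_pos x with rfl | hx
  · exact leading_zero (by omega) hb hm
  rcases Nat.eq_zero_or_pos y with rfl | hy
  · exact swap (leading_zero (by omega) ha (by rw [List.length_cons]; omega))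
  rcases lt_trichotomy x y with lt | rfl | lt
  · exact swap (longer hx lt hb ha (by rw [List.length_cons, List.length_cons]; omega))
  · exact delete hy (ih _ (by omega) _ _ _ (by omega) (by omega) rfl)
  · exact longer hy lt ha hb hm

section Moves

variable {K : Type*} [Field K] {N o y : ℕ} {a b : List ℕ} {F X : ℕ → ℕ → K}

theorem IsMeanderForm.swap (hF : IsMeanderForm N o a b F) :
    IsMeanderForm N o b a fun i j => F j i where
  sum_top := hF.sum_bottom
  sum_bottom := hF.sum_top
  exists_grading := hF.exists_grading.imp' _ fun _ => IsGraded.swap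
  ne_zero_iff hij := (hF.ne_zero_iff hij.symm).trans ⟨DirectedArc.swap, DirectedArc.swap⟩

theorem InMeanderKernel.swap (hX : InMeanderKernel N o a b F X) :
    InMeanderKernel N o b a (fun i j => F j i) fun i j => X j i where
  admissible hij h := (hX.admissible hij.symm h).swap
  comm h := by rw [commOn_transpose, hX.comm h.swap, neg_zero]

theorem IsDiagonalAlong.swap (h : IsDiagonalAlong N o b a fun i j => X j i) :
    IsDiagonalAlong N o a b X where
  diagonal i hi j hj hij := h.diagonal j hj i hi hij.symm
  isGraded i j arc := by
    have := h.isGraded arc.swap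
    simp only [add_zero] at this ⊢
    exact this.symm

theorem admissibleFrom_one_cons {i j : ℕ} (hij : i ≠ j) :
    AdmissibleFrom o (1 :: a) (1 :: b) i j ↔ AdmissibleFrom (o + 1) a b i j := by
  rw [admissibleFrom_cons_cons, AdmissibleFrom]
  refine or_congr (and_congr_right fun h => or_iff_right ?_)
    (and_congr_right fun h => or_iff_right ?_) <;> omega

theorem IsMeanderForm.of_zero_cons (hF : IsMeanderForm N o (0 :: a) b F) :
    IsMeanderForm N o a b F where
  sum_top := by simpa only [List.sum_cons, zero_add] using hF.sum_top
  sum_bottom := hF.sum_bottom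
  exists_grading := hF.exists_grading.imp fun _ => isGraded_zero_cons.1
  ne_zero_iff hij := (hF.ne_zero_iff hij).trans directedArc_zero_cons

theorem InMeanderKernel.of_zero_cons (hX : InMeanderKernel N o (0 :: a) b F X) :
    InMeanderKernel N o a b F X where
  admissible hij h := admissibleFrom_zero_cons.1 (hX.admissible hij h)
  comm h := hX.comm (admissibleFrom_zero_cons.2 h)

theorem IsDiagonalAlong.zero_cons (h : IsDiagonalAlong N o a b X) :
    IsDiagonalAlong N o (0 :: a) b X where
  diagonal := h.diagonal
  isGraded := isGraded_zero_cons.2 h.isGraded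

theorem IsMeanderForm.le_one (hF : IsMeanderForm N o (y :: a) (y :: b) F) : y ≤ 1 := by
  obtain ⟨g, hg⟩ := hF.exists_grading
  by_contra! hy
  have top : g o = g (o + y - 1) + 2 :=
    hg (.inl ⟨by omega, arcFrom_cons.2 (.inl (by unfold Mirrored; omega))⟩)
  have bottom : g (o + y - 1) = g o + 2 :=
    hg (.inr ⟨by omega, arcFrom_cons.2 (.inl (by unfold Mirrored; omega))⟩)
  omega

theorem IsMeanderForm.of_one_cons (hF : IsMeanderForm N o (1 :: a) (1 :: b) F) :
    IsMeanderForm N (o + 1) a b F where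
  sum_top := by simpa only [List.sum_cons, add_assoc] using hF.sum_top
  sum_bottom := by simpa only [List.sum_cons, add_assoc] using hF.sum_bottom
  exists_grading := hF.exists_grading.imp fun _ => isGraded_one_cons.1
  ne_zero_iff hij := (hF.ne_zero_iff hij).trans directedArc_one_cons

theorem InMeanderKernel.eq_zero_of_one_cons (hX : InMeanderKernel N o (1 :: a) (1 :: b) F X)
    {i j : ℕ} (hij : i ≠ j) (h : i ≤ o ∨ j ≤ o) : X i j = 0 := by
  by_contra ne
  have adm := (admissibleFrom_one_cons hij).1 (hX.admissible hij ne)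
  simp only [AdmissibleFrom, SameBlockFrom] at adm
  omega

theorem InMeanderKernel.of_one_cons (hN : o < N)
    (hX : InMeanderKernel N o (1 :: a) (1 :: b) F X) : InMeanderKernel N (o + 1) a b F X where
  admissible hij h := (admissibleFrom_one_cons hij).1 (hX.admissible hij h)
  comm {i j} h := by
    have adm : AdmissibleFrom o (1 :: a) (1 :: b) i j := by
      rw [admissibleFrom_cons_cons]
      exact h.imp (fun h => ⟨h.1, .inr h.2⟩) fun h => ⟨h.1, .inr h.2⟩
    have ⟨hi, hj⟩ : o < i ∧ o < j := h.elim (fun h => ⟨h.2.1, h.2.2.1⟩) fun h => ⟨h.2.1, h.2.2.1⟩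
    have comm := hX.comm adm
    rwa [commOn_Ico (Nat.le_succ o) hN, commOn, Nat.Ico_succ_singleton, Finset.sum_singleton,
      hX.eq_zero_of_one_cons hi.ne (.inl le_rfl), hX.eq_zero_of_one_cons hj.ne' (.inr le_rfl),
      mul_zero, zero_mul, sub_zero, zero_add] at comm

theorem IsDiagonalAlong.of_one_cons (hX : InMeanderKernel N o (1 :: a) (1 :: b) F X)
    (h : IsDiagonalAlong N (o + 1) a b X) : IsDiagonalAlong N o (1 :: a) (1 :: b) X where
  diagonal i hi j hj hij := by
    by_cases ho : i ≤ o ∨ j ≤ o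
    · exact hX.eq_zero_of_one_cons hij ho
    · rw [mem_Ico] at hi hj
      exact h.diagonal i (mem_Ico.2 (by omega)) j (mem_Ico.2 (by omega)) hij
  isGraded := isGraded_one_cons.2 h.isGraded

end Moves

theorem InMeanderKernel.isDiagonalAlong {K : Type*} [Field K] {N o : ℕ} {a b : List ℕ}
    {F X : ℕ → ℕ → K} (hX : InMeanderKernel N o a b F X) (hF : IsMeanderForm N o a b F) :
    IsDiagonalAlong N o a b X := by
  refine meander_induction (N := N) (motive := fun o a b => ∀ F X : ℕ → ℕ → K,
    IsMeanderForm N o a b F → InMeanderKernel N o a b F X → IsDiagonalAlong N o a b X)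
    ?_ ?_ ?_ ?_ ?_ o a b hF.sum_top hF.sum_bottom F X hF hX
  · intro F X _ _
    refine ⟨fun i hi => ?_, fun i j arc => ?_⟩
    · simp only [Finset.Ico_self, Finset.notMem_empty] at hi
    · exact (arc.elim (fun h => not_arcFrom_nil h.2) fun h => not_arcFrom_nil h.2).elim
  · exact fun ih F X hF hX => (ih _ _ hF.swap hX.swap).swap
  · exact fun ih F X hF hX => (ih F X hF.of_zero_cons hX.of_zero_cons).zero_cons
  · intro o y a b hy ih F X hF hX
    obtain rfl : y = 1 := le_antisymm hF.le_one hy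
    have hN : o < N := by have := hF.sum_top; rw [List.sum_cons] at this; omega
    exact (ih F X hF.of_one_cons (hX.of_one_cons hN)).of_one_cons hX
  · exact fun _ _ ih F X hF hX =>
      hX.isDiagonalAlong_of_fold hF (ih _ _ hF.fold (hX.fold hF))

section Append

variable {o p i j i' j' : ℕ} {c d : List ℕ}

theorem arcFrom_append :
    ArcFrom o (c ++ d) i j ↔ ArcFrom o c i j ∨ ArcFrom (o + c.sum) d i j := by
  induction c generalizing o with
  | nil => simp [not_arcFrom_nil]
  | cons x c ih =>
    simp only [List.cons_append, arcFrom_cons, ih, List.sum_cons, add_assoc, or_assoc]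

theorem sameBlockFrom_append :
    SameBlockFrom o (c ++ d) i j ↔ SameBlockFrom o c i j ∨ SameBlockFrom (o + c.sum) d i j := by
  induction c generalizing o with
  | nil => simp [not_sameBlockFrom_nil]
  | cons x c ih =>
    simp only [List.cons_append, sameBlockFrom_cons, ih, List.sum_cons, add_assoc, or_assoc]

theorem arcFrom_reverse (hi : i + i' + 1 = o + p + c.sum) (hj : j + j' + 1 = o + p + c.sum) :
    ArcFrom p c.reverse i' j' ↔ ArcFrom o c i j := by
  induction c generalizing o with
  | nil => exact iff_of_false not_arcFrom_nil not_arcFrom_nil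
  | cons d c ih =>
    rw [List.sum_cons] at hi hj
    have first : Mirrored (p + c.sum) (p + c.sum + d) i' j' ↔ Mirrored o (o + d) i j := by
      unfold Mirrored
      omega
    rw [List.reverse_cons, arcFrom_append, List.sum_reverse, arcFrom_cons, arcFrom_cons,
      or_iff_left not_arcFrom_nil, first, ih (o := o + d) (by omega) (by omega), or_comm]

theorem sameBlockFrom_reverse (hi : i + i' + 1 = o + p + c.sum)
    (hj : j + j' + 1 = o + p + c.sum) :
    SameBlockFrom p c.reverse i' j' ↔ SameBlockFrom o c i j := by
  induction c generalizing o with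
  | nil => exact iff_of_false not_sameBlockFrom_nil not_sameBlockFrom_nil
  | cons d c ih =>
    rw [List.sum_cons] at hi hj
    have first : (p + c.sum ≤ i' ∧ p + c.sum ≤ j' ∧ i' < p + c.sum + d ∧ j' < p + c.sum + d) ↔
        (o ≤ i ∧ o ≤ j ∧ i < o + d ∧ j < o + d) := by
      omega
    rw [List.reverse_cons, sameBlockFrom_append, List.sum_reverse, sameBlockFrom_cons,
      sameBlockFrom_cons, or_iff_left not_sameBlockFrom_nil, first,
      ih (o := o + d) (by omega) (by omega), or_comm]

theorem sameBlockFrom_self (ho : o ≤ i) (hi : i < o + c.sum) : SameBlockFrom o c i i := by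
  induction c generalizing o with
  | nil => simp only [List.sum_nil] at hi; omega
  | cons x c ih =>
    rw [List.sum_cons] at hi
    rw [sameBlockFrom_cons]
    by_cases h : i < o + x
    · exact .inl ⟨ho, ho, h, h⟩
    · exact .inr (ih (by omega) (by omega))

end Append

section FullComposition

variable {n i j : ℕ} {a b c : List ℕ}

theorem sum_fullComposition (hc : c.sum ≤ n) : (fullComposition n c).sum = 2 * n := by
  simp only [fullComposition, List.sum_append, List.sum_cons, List.sum_reverse]
  omega

theorem reverse_fullComposition : (fullComposition n c).reverse = fullComposition n c := by
  simp [fullComposition]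

theorem sameBlockFrom_fullComposition_mirror (hc : c.sum ≤ n) (hi : i < 2 * n)
    (hj : j < 2 * n) :
    SameBlockFrom 0 (fullComposition n c) (mirror 0 (2 * n) i) (mirror 0 (2 * n) j) ↔
      SameBlockFrom 0 (fullComposition n c) i j := by
  have h := sameBlockFrom_reverse (c := fullComposition n c) (o := 0) (p := 0) (i := i) (j := j)
    (i' := mirror 0 (2 * n) i) (j' := mirror 0 (2 * n) j)
    (by rw [sum_fullComposition hc]; unfold mirror; omega)
    (by rw [sum_fullComposition hc]; unfold mirror; omega)
  rwa [reverse_fullComposition] at h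

theorem arcFrom_fullComposition (hc : c.sum ≤ n) (hi : i < 2 * n) (hj : j < 2 * n) :
    ArcFrom 0 (fullComposition n c) i j ↔
      ArcFrom 0 c i j ∨ Mirrored c.sum (2 * n - c.sum) i j ∨
        ArcFrom 0 c (mirror 0 (2 * n) i) (mirror 0 (2 * n) j) := by
  rw [fullComposition, arcFrom_append, arcFrom_cons, zero_add,
    show c.sum + 2 * (n - c.sum) = 2 * n - c.sum by omega,
    arcFrom_reverse (o := 0) (i := mirror 0 (2 * n) i) (j := mirror 0 (2 * n) j)
      (by unfold mirror; omega) (by unfold mirror; omega)]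

theorem directedArc_fullComposition (ha : a.sum ≤ n) (hb : b.sum ≤ n) (hi : i < 2 * n)
    (hj : j < 2 * n) :
    DirectedArc 0 (fullComposition n a) (fullComposition n b) i j ↔
      DirectedArc 0 a b i j ∨ DirectedArc 0 a b (mirror 0 (2 * n) j) (mirror 0 (2 * n) i) ∨
        (a.sum ≤ j ∧ j < n ∧ i = mirror 0 (2 * n) j) ∨
        (b.sum ≤ i ∧ i < n ∧ j = mirror 0 (2 * n) i) := by
  have lt_mirror : mirror 0 (2 * n) i < mirror 0 (2 * n) j ↔ j < i := by unfold mirror; omega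
  have mirror_lt : mirror 0 (2 * n) j < mirror 0 (2 * n) i ↔ i < j := by unfold mirror; omega
  have top : (j < i ∧ Mirrored a.sum (2 * n - a.sum) i j) ↔
      (a.sum ≤ j ∧ j < n ∧ i = mirror 0 (2 * n) j) := by
    unfold Mirrored mirror
    omega
  have bottom : (i < j ∧ Mirrored b.sum (2 * n - b.sum) i j) ↔
      (b.sum ≤ i ∧ i < n ∧ j = mirror 0 (2 * n) i) := by
    unfold Mirrored mirror
    omega
  have comm (c : List ℕ) : ArcFrom 0 c (mirror 0 (2 * n) j) (mirror 0 (2 * n) i) ↔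
      ArcFrom 0 c (mirror 0 (2 * n) i) (mirror 0 (2 * n) j) := ⟨.symm, .symm⟩
  rw [DirectedArc, DirectedArc, DirectedArc, arcFrom_fullComposition ha hi hj,
    arcFrom_fullComposition hb hi hj, ← top, ← bottom, comm, comm, lt_mirror, mirror_lt]
  simp only [and_or_left]
  grind only

theorem DirectedArc.lt (h : DirectedArc 0 a b i j) (ha : a.sum ≤ n) (hb : b.sum ≤ n) :
    i < n ∧ j < n := by
  rcases h.admissibleFrom with ⟨-, h⟩ | ⟨-, h⟩
  · exact ⟨h.lt.1.trans_le (by rwa [zero_add]), h.lt.2.trans_le (by rwa [zero_add])⟩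
  · exact ⟨h.lt.1.trans_le (by rwa [zero_add]), h.lt.2.trans_le (by rwa [zero_add])⟩

theorem DirectedArc.fullComposition (h : DirectedArc 0 a b i j) :
    DirectedArc 0 (fullComposition n a) (fullComposition n b) i j :=
  h.imp (fun h => ⟨h.1, arcFrom_append.2 (.inl h.2)⟩) fun h => ⟨h.1, arcFrom_append.2 (.inl h.2)⟩

/-- The extension of a function on the vertices `0, …, n - 1` to the vertices `0, …, 2n - 1` of
the full meander that is odd under reflection. -/
def oddExtension {R : Type*} [Neg R] (n : ℕ) (f : ℕ → R) (i : ℕ) : R :=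
  if i < n then f i else -f (mirror 0 (2 * n) i)

theorem oddExtension_of_lt {R : Type*} [Neg R] {f : ℕ → R} (hi : i < n) :
    oddExtension n f i = f i :=
  if_pos hi

theorem oddExtension_mirror {R : Type*} [Neg R] {f : ℕ → R} (hi : i < n) :
    oddExtension n f (mirror 0 (2 * n) i) = -f i := by
  rw [oddExtension, if_neg (by unfold mirror; omega), mirror_mirror i.zero_le (by omega)]

theorem IsGraded.isGraded_oddExtension {R : Type*} [AddCommGroup R] {d : R} {f : ℕ → R}
    (ha : a.sum ≤ n) (hb : b.sum ≤ n) (hf : IsGraded 0 d a b f)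
    (top : ∀ i < n, a.sum ≤ i → f i = -f i + d) (bottom : ∀ i < n, b.sum ≤ i → -f i = f i + d) :
    IsGraded 0 d (fullComposition n a) (fullComposition n b) (oddExtension n f) := by
  intro i j arc
  obtain ⟨hi, hj⟩ := arc.lt (sum_fullComposition ha).le (sum_fullComposition hb).le
  rcases (directedArc_fullComposition ha hb hi hj).1 arc with
    h | h | ⟨hj, hj', rfl⟩ | ⟨hi, hi', rfl⟩
  · obtain ⟨hi, hj⟩ := h.lt ha hb
    rw [oddExtension_of_lt hi, oddExtension_of_lt hj]
    exact hf h
  · obtain ⟨hj', hi'⟩ := h.lt ha hb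
    rw [← mirror_mirror i.zero_le (by omega : i < 2 * n),
      ← mirror_mirror j.zero_le (by omega : j < 2 * n), oddExtension_mirror hi',
      oddExtension_mirror hj', hf h]
    abel
  · rw [oddExtension_mirror hj', oddExtension_of_lt hj']
    exact top j hj' hj
  · rw [oddExtension_mirror hi', oddExtension_of_lt hi']
    exact bottom i hi' hi

theorem HasTailGrading.inTailFrom {N o : ℕ} (h : HasTailGrading N o a b) (hi : i < N)
    (le : o + a.sum ≤ i ∨ o + b.sum ≤ i) : InTailFrom o a b i := by
  obtain ⟨g, -, bottom, top⟩ := h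
  have not_both : ¬ (o + a.sum ≤ i ∧ o + b.sum ≤ i) := fun ⟨ha, hb⟩ => by
    have := (bottom i hi hb).symm.trans (top i hi ha)
    omega
  unfold InTailFrom Xor
  tauto

theorem HasTailGrading.exists_isGraded_fullComposition (h : HasTailGrading n 0 a b)
    (ha : a.sum ≤ n) (hb : b.sum ≤ n) :
    ∃ g : ℕ → ℤ, IsGraded 0 2 (fullComposition n a) (fullComposition n b) g := by
  obtain ⟨g, hg, bottom, top⟩ := h
  refine ⟨_, hg.isGraded_oddExtension ha hb (fun i hi hai => ?_) fun i hi hbi => ?_⟩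
  · rw [top i hi (by rwa [zero_add])]
    norm_num
  · rw [bottom i hi (by rwa [zero_add])]
    norm_num

theorem IsTailFreeInvariant.isGraded_oddExtension {R : Type*} [AddCommGroup R] {f : ℕ → R}
    (hf : IsTailFreeInvariant 0 a b f) (h : HasTailGrading n 0 a b) (ha : a.sum ≤ n)
    (hb : b.sum ≤ n) :
    IsGraded 0 0 (fullComposition n a) (fullComposition n b) (oddExtension n f) := by
  have eq_zero {i : ℕ} (hi : i < n) (le : a.sum ≤ i ∨ b.sum ≤ i) : f i = 0 :=
    hf.2 i (h.inTailFrom hi (by rwa [zero_add, zero_add]))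
  refine hf.1.isGraded_oddExtension ha hb (fun i hi hai => ?_) fun i hi hbi => ?_
  · rw [eq_zero hi (.inl hai), neg_zero, add_zero]
  · rw [eq_zero hi (.inr hbi), neg_zero, add_zero]

theorem IsGraded.isTailFreeInvariant_of_odd {R : Type*} [AddCommGroup R] [IsAddTorsionFree R]
    {f : ℕ → R} (hf : IsGraded 0 0 (fullComposition n a) (fullComposition n b) f)
    (odd : ∀ i < n, f (mirror 0 (2 * n) i) = -f i) (ha : a.sum ≤ n) (hb : b.sum ≤ n) :
    IsTailFreeInvariant 0 a b f := by
  refine ⟨fun i j arc => hf arc.fullComposition, fun i tail => ?_⟩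
  rw [InTailFrom, zero_add, zero_add] at tail
  have hi : i < n := by rcases tail with h | h <;> omega
  have lt_mirror : mirror 0 (2 * n) i < 2 * n := by unfold mirror; omega
  have arc_iff {i j : ℕ} := directedArc_fullComposition (i := i) (j := j) ha hb
  refine self_eq_neg.1 (Eq.trans ?_ (odd i hi))
  rcases tail with ⟨le, -⟩ | ⟨le, -⟩
  · have := hf ((arc_iff lt_mirror (by omega)).2 (.inr (.inr (.inl ⟨le, hi, rfl⟩))))
    rwa [add_zero] at this
  · have := hf ((arc_iff (by omega) lt_mirror).2 (.inr (.inr (.inr ⟨le, hi, rfl⟩))))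
    rw [this, add_zero]

end FullComposition

section Components

variable {n : ℕ} {a b : List ℕ} {P : (meander n a b).ConnectedComponent}

theorem inTailFrom_zero {i : ℕ} : InTailFrom 0 a b i ↔ InTail a b i := by
  rw [InTailFrom, InTail, zero_add, zero_add]

theorem isEndpointFrom_zero {i : ℕ} : IsEndpointFrom 0 a b i ↔ IsEndpoint a b i := by
  simp only [IsEndpointFrom, IsEndpoint, arcFrom_zero]

theorem meander_adj_iff {i j : Fin n} :
    (meander n a b).Adj i j ↔ DirectedArc 0 a b i j ∨ DirectedArc 0 a b j i := by
  have comm (c : List ℕ) : Arc c j i ↔ Arc c i j := ⟨.symm, .symm⟩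
  change Arc a i j ∨ Arc b i j ↔ _
  simp only [DirectedArc, arcFrom_zero, comm]
  have (c : List ℕ) (h : Arc c i j) : (i : ℕ) ≠ j := h.ne
  grind

theorem InTail.lt {i : ℕ} (h : InTail a b i) (ha : a.sum ≤ n) (hb : b.sum ≤ n) : i < n := by
  rcases h with h | h <;> omega

theorem InTail.isEndpoint {i : ℕ} (h : InTail a b i) : IsEndpoint a b i := by
  rintro ⟨⟨j, top⟩, k, bottom⟩
  have := top.sameBlock.lt_sum
  have := bottom.sameBlock.lt_sum
  rcases h with h | h <;> omega

theorem IsGraded.eq_of_reachable {R : Type*} [AddCommGroup R] {f : ℕ → R}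
    (hf : IsGraded 0 0 a b f) {i j : Fin n} (h : (meander n a b).Reachable i j) : f i = f j := by
  obtain ⟨w⟩ := h
  induction w with
  | nil => rfl
  | cons adj _ ih =>
    refine Eq.trans ?_ ih
    rcases meander_adj_iff.1 adj with arc | arc
    · rw [hf arc, add_zero]
    · rw [hf arc, add_zero]

/-- The indicator function of a set of vertices, as a function on `ℕ` that vanishes from `n` on. -/
noncomputable def vertexIndicator (V : Set (Fin n)) : ℕ → ℂ :=
  (Fin.val '' V).indicator 1

theorem vertexIndicator_of_mem {V : Set (Fin n)} {i : Fin n} (h : i ∈ V) :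
    vertexIndicator V i = 1 :=
  Set.indicator_of_mem (Set.mem_image_of_mem _ h) _

theorem vertexIndicator_of_notMem {V : Set (Fin n)} {i : Fin n} (h : i ∉ V) :
    vertexIndicator V i = 0 :=
  Set.indicator_of_notMem (by rwa [Fin.val_injective.mem_set_image]) _

theorem vertexIndicator_of_le {V : Set (Fin n)} {i : ℕ} (h : n ≤ i) : vertexIndicator V i = 0 :=
  Set.indicator_of_notMem (by rintro ⟨j, -, rfl⟩; exact h.not_gt j.2) _

theorem isGraded_vertexIndicator (P : (meander n a b).ConnectedComponent) (ha : a.sum ≤ n)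
    (hb : b.sum ≤ n) : IsGraded 0 0 a b (vertexIndicator P.supp) := by
  intro i j arc
  obtain ⟨hi, hj⟩ := arc.lt ha hb
  lift i to Fin n using hi
  lift j to Fin n using hj
  have adj : (meander n a b).Adj i j := meander_adj_iff.2 (.inl arc)
  have mem_iff : i ∈ P.supp ↔ j ∈ P.supp := P.mem_supp_congr_adj adj
  rw [add_zero]
  by_cases hi : i ∈ P.supp
  · rw [vertexIndicator_of_mem hi, vertexIndicator_of_mem (mem_iff.1 hi)]
  · rw [vertexIndicator_of_notMem hi, vertexIndicator_of_notMem (mem_iff.not.1 hi)]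

theorem IsTailFreePath.isTailFreeInvariant (hP : IsTailFreePath n a b P) (ha : a.sum ≤ n)
    (hb : b.sum ≤ n) : IsTailFreeInvariant 0 a b (vertexIndicator P.supp) := by
  refine ⟨isGraded_vertexIndicator P ha hb, fun i tail => ?_⟩
  rw [inTailFrom_zero] at tail
  lift i to Fin n using tail.lt ha hb
  exact vertexIndicator_of_notMem fun h => hP.2 i h tail.isEndpoint tail

theorem IsTailFreePath.mem_supp (hP : IsTailFreePath n a b P) {p : Fin 1 → ℕ}
    (hp : IsPathSystem ℂ n 0 a b p) (ha : a.sum ≤ n) (hb : b.sum ≤ n) :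
    (⟨p 0, hp.lt 0⟩ : Fin n) ∈ P.supp := by
  by_contra h
  obtain ⟨i, hi, -⟩ := hP.1
  have eq_zero : vertexIndicator P.supp i = 0 := hp.eq_zero (hP.isTailFreeInvariant ha hb)
    (Fin.forall_fin_one.2 (vertexIndicator_of_notMem h)) (Nat.zero_le i) i.2
  exact one_ne_zero ((vertexIndicator_of_mem hi).symm.trans eq_zero)

theorem IsPathSystem.existsUnique_isTailFreePath {p : Fin 1 → ℕ}
    (hp : IsPathSystem ℂ n 0 a b p) (ha : a.sum ≤ n) (hb : b.sum ≤ n) :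
    ∃! P : (meander n a b).ConnectedComponent, IsTailFreePath n a b P := by
  refine ⟨(meander n a b).connectedComponentMk ⟨p 0, hp.lt 0⟩, ⟨⟨_, rfl, ?_⟩, ?_⟩, ?_⟩
  · exact isEndpointFrom_zero.1 (hp.isEndpoint 0)
  · intro i hi _ tail
    obtain ⟨f, hf, ne_zero⟩ := hp.exists_ne_zero
    have eq := hf.1.eq_of_reachable (SimpleGraph.ConnectedComponent.exact hi)
    rw [hf.2 i (inTailFrom_zero.2 tail)] at eq
    exact ne_zero 0 eq.symm
  · exact fun P hP => (hP.mem_supp hp ha hb).symm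

theorem IsTailFreePath.eq_mul_vertexIndicator (hP : IsTailFreePath n a b P) {p : Fin 1 → ℕ}
    (hp : IsPathSystem ℂ n 0 a b p) (ha : a.sum ≤ n) (hb : b.sum ≤ n) {f : ℕ → ℂ}
    (hf : IsTailFreeInvariant 0 a b f) {i : ℕ} (hi : i < n) :
    f i = f (p 0) * vertexIndicator P.supp i := by
  have hv := hP.isTailFreeInvariant ha hb
  have invariant : IsTailFreeInvariant 0 a b fun i => f i - f (p 0) * vertexIndicator P.supp i :=
    ⟨fun i j arc => by simp only [hf.1 arc, hv.1 arc, add_zero],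
      fun i tail => by simp only [hf.2 i tail, hv.2 i tail, mul_zero, sub_zero]⟩
  have at_point : vertexIndicator P.supp (p 0) = 1 :=
    vertexIndicator_of_mem (hP.mem_supp hp ha hb)
  refine sub_eq_zero.1 (hp.eq_zero invariant (Fin.forall_fin_one.2 ?_) i.zero_le hi)
  rw [at_point, mul_one, sub_self]

end Components

section Symplectic

variable {n : ℕ} {a b : List ℕ}

/-- The sign `ε_i` of the index `i`. -/
noncomputable def indexSign (i : Fin (2 * n)) : ℂ := if (i : ℕ) < n then 1 else -1

theorem indexSign_mul_self (i : Fin (2 * n)) : indexSign i * indexSign i = 1 := by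
  unfold indexSign
  split_ifs <;> ring

theorem val_rev_eq_mirror (i : Fin (2 * n)) : (i.rev : ℕ) = mirror 0 (2 * n) i := by
  rw [Fin.val_rev, mirror]
  omega

theorem indexSign_rev (i : Fin (2 * n)) : indexSign i.rev = -indexSign i := by
  have hi : (i.rev : ℕ) < n ↔ ¬ (i : ℕ) < n := by rw [Fin.val_rev]; omega
  rw [indexSign, indexSign, if_congr hi rfl rfl]
  split_ifs <;> ring

/-- The involution of the matrix algebra whose fixed points form `sp(2n)`. -/
noncomputable def spInvolution (n : ℕ) :
    Matrix (Fin (2 * n)) (Fin (2 * n)) ℂ →ₗ[ℂ] Matrix (Fin (2 * n)) (Fin (2 * n)) ℂ where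
  toFun M := Matrix.of fun i j => -indexSign i * indexSign j * M j.rev i.rev
  map_add' M N := by ext; simp only [Matrix.of_apply, Matrix.add_apply, mul_add]
  map_smul' c M := by
    ext
    simp only [Matrix.of_apply, Matrix.smul_apply, smul_eq_mul, RingHom.id_apply]
    ring

/-- Twice the projection of the matrix algebra onto `sp(2n)`. -/
noncomputable def spPart (n : ℕ) :
    Matrix (Fin (2 * n)) (Fin (2 * n)) ℂ →ₗ[ℂ] Matrix (Fin (2 * n)) (Fin (2 * n)) ℂ :=
  LinearMap.id + spInvolution n

variable {M X Z : Matrix (Fin (2 * n)) (Fin (2 * n)) ℂ}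

theorem spInvolution_apply (i j : Fin (2 * n)) :
    spInvolution n M i j = -indexSign i * indexSign j * M j.rev i.rev :=
  rfl

theorem spPart_apply (i j : Fin (2 * n)) :
    spPart n M i j = M i j - indexSign i * indexSign j * M j.rev i.rev := by
  rw [spPart, LinearMap.add_apply, Matrix.add_apply, spInvolution_apply, LinearMap.id_apply]
  ring

theorem mem_sp_iff_apply : X ∈ sp n ↔ ∀ i j, X i j = -indexSign i * indexSign j * X j.rev i.rev :=
  mem_sp n X

theorem spPart_mem_sp (M : Matrix (Fin (2 * n)) (Fin (2 * n)) ℂ) : spPart n M ∈ sp n := by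
  refine mem_sp_iff_apply.2 fun i j => ?_
  simp only [spPart_apply, Fin.rev_rev, indexSign_rev]
  linear_combination (-(indexSign j * indexSign j) * M i j) * indexSign_mul_self i -
    M i j * indexSign_mul_self j

theorem trace_spInvolution_mul (hZ : Z ∈ sp n) :
    (spInvolution n M * Z).trace = (M * Z).trace := by
  have entry (i j : Fin (2 * n)) :
      spInvolution n M i j * Z j i = M j.rev i.rev * Z i.rev j.rev := by
    rw [mem_sp_iff_apply.1 hZ j i, spInvolution_apply]
    linear_combination (indexSign j * indexSign j * (M j.rev i.rev * Z i.rev j.rev)) *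
      indexSign_mul_self i + M j.rev i.rev * Z i.rev j.rev * indexSign_mul_self j
  simp only [Matrix.trace, Matrix.diag_apply, Matrix.mul_apply, entry]
  rw [Finset.sum_comm, ← Equiv.sum_comp Fin.revPerm fun i => ∑ j, M i j * Z j i]
  exact Finset.sum_congr rfl fun i _ =>
    Equiv.sum_comp Fin.revPerm fun j => M i.rev j * Z j i.rev

theorem trace_spPart_mul (hZ : Z ∈ sp n) : (spPart n M * Z).trace = 2 * (M * Z).trace := by
  rw [spPart, LinearMap.add_apply, LinearMap.id_apply, add_mul, Matrix.trace_add,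
    trace_spInvolution_mul hZ]
  exact (two_mul _).symm

theorem mem_seaweed :
    X ∈ seaweed n a b ↔ X ∈ sp n ∧ ∀ i j, ¬ Admissible n a b i j → X i j = 0 :=
  Iff.rfl

theorem admissible_iff {i j : Fin (2 * n)} :
    Admissible n a b i j ↔ AdmissibleFrom 0 (fullComposition n a) (fullComposition n b) i j := by
  rw [Admissible, AdmissibleFrom, sameBlockFrom_zero, sameBlockFrom_zero, Fin.le_def, Fin.le_def]

theorem orientedFullEdge_iff {i j : Fin (2 * n)} :
    OrientedFullEdge n a b i j ↔
      DirectedArc 0 (fullComposition n a) (fullComposition n b) i j := by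
  rw [OrientedFullEdge, DirectedArc, arcFrom_zero, arcFrom_zero, Fin.lt_def, Fin.lt_def]

theorem Admissible.rev {i j : Fin (2 * n)} (h : Admissible n a b i j) (ha : a.sum ≤ n)
    (hb : b.sum ≤ n) : Admissible n a b j.rev i.rev := by
  have rev_sameBlock {c : List ℕ} (hc : c.sum ≤ n) (h : SameBlock (fullComposition n c) i j) :
      SameBlock (fullComposition n c) j.rev i.rev := by
    rw [val_rev_eq_mirror, val_rev_eq_mirror, ← sameBlockFrom_zero,
      sameBlockFrom_fullComposition_mirror hc j.2 i.2, sameBlockFrom_zero]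
    exact h.symm
  exact h.imp (fun h => ⟨Fin.rev_le_rev.2 h.1, rev_sameBlock ha h.2⟩)
    fun h => ⟨Fin.rev_le_rev.2 h.1, rev_sameBlock hb h.2⟩

theorem Admissible.refl (ha : a.sum ≤ n) (i : Fin (2 * n)) : Admissible n a b i i := by
  rw [admissible_iff]
  exact .inl ⟨le_rfl, sameBlockFrom_self i.1.zero_le (by rw [sum_fullComposition ha]; omega)⟩

theorem spPart_mem_seaweed (ha : a.sum ≤ n) (hb : b.sum ≤ n)
    (hM : ∀ i j, ¬ Admissible n a b i j → M i j = 0) : spPart n M ∈ seaweed n a b := by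
  refine mem_seaweed.2 ⟨spPart_mem_sp M, fun i j h => ?_⟩
  rw [spPart_apply, hM i j h, hM j.rev i.rev fun h' => h (by simpa using h'.rev ha hb),
    mul_zero, sub_zero]

theorem OrientedFullEdge.rev {i j : Fin (2 * n)} (h : OrientedFullEdge n a b i j)
    (ha : a.sum ≤ n) (hb : b.sum ≤ n) : OrientedFullEdge n a b j.rev i.rev := by
  have mirror_mirror (i : Fin (2 * n)) : mirror 0 (2 * n) (mirror 0 (2 * n) i) = i :=
    SeaweedC.mirror_mirror (Nat.zero_le i) i.2
  rw [orientedFullEdge_iff, directedArc_fullComposition ha hb i.2 j.2] at h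
  rw [orientedFullEdge_iff, directedArc_fullComposition ha hb j.rev.2 i.rev.2, val_rev_eq_mirror,
    val_rev_eq_mirror, mirror_mirror, mirror_mirror]
  rcases h with h | h | ⟨hj, hj', eq⟩ | ⟨hi, hi', eq⟩
  · exact .inr (.inl h)
  · exact .inl h
  · have eq' : mirror 0 (2 * n) i = j := by rw [eq, mirror_mirror]
    exact .inr (.inr (.inl ⟨eq' ▸ hj, eq' ▸ hj', eq.symm⟩))
  · have eq' : mirror 0 (2 * n) j = i := by rw [eq, mirror_mirror]
    exact .inr (.inr (.inr ⟨eq' ▸ hi, eq' ▸ hi', eq.symm⟩))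

end Symplectic

section KirillovForm

variable {n : ℕ} {a b : List ℕ} {V : Set (Fin n)}

open Classical in
theorem sum_lift {E : Type*} [AddCommGroup E] [Module ℂ E] (V : Set (Fin n))
    (f : Fin (2 * n) → E) :
    ∑ i : Fin n with i ∈ V, f (lift i) = ∑ p : Fin (2 * n), vertexIndicator V p • f p := by
  have lift_injective : Function.Injective (lift : Fin n → Fin (2 * n)) :=
    Fin.castLE_injective (Nat.le_mul_of_pos_left n two_pos)
  refine Finset.sum_of_injOn lift lift_injective.injOn (fun _ _ => Finset.mem_coe.2
    (Finset.mem_univ _)) (fun p _ hp => ?_) fun i hi => ?_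
  · have eq_zero : vertexIndicator V p = 0 := by
      refine Set.indicator_of_notMem ?_ _
      rintro ⟨i, hi, eq⟩
      exact hp ⟨i, by simpa using hi, Fin.ext eq⟩
    rw [eq_zero, zero_smul]
  · have eq_one : vertexIndicator V (lift i : Fin (2 * n)) = 1 :=
      vertexIndicator_of_mem (Finset.mem_filter.1 hi).2
    rw [eq_one, one_smul]

open Classical in
/-- The matrix whose trace form is `φ_(1)`: its `(q, p)` entry is the coefficient of
`e_{p,q}^*`. -/
noncomputable def phiCoeff (n : ℕ) (a b : List ℕ) (V : Set (Fin n)) :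
    Matrix (Fin (2 * n)) (Fin (2 * n)) ℂ :=
  Matrix.diagonal (fun p : Fin (2 * n) => vertexIndicator V p) +
    Matrix.of fun q p => if OrientedFullEdge n a b p q ∧ ((p : ℕ) < n ∨ (q : ℕ) < n) then 1 else 0

/-- The element of `sp(2n)` that represents `2 φ_(1)` under the trace form. -/
noncomputable def phiMatrix (n : ℕ) (a b : List ℕ) (V : Set (Fin n)) :
    Matrix (Fin (2 * n)) (Fin (2 * n)) ℂ :=
  spPart n (phiCoeff n a b V)

theorem phiOne_apply (Z : seaweed n a b) :
    phiOne n a b V Z = (phiCoeff n a b V * Z.1).trace := by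
  classical
  have edges : ∑ p : Fin (2 * n) × Fin (2 * n) with
        OrientedFullEdge n a b p.1 p.2 ∧ ((p.1 : ℕ) < n ∨ (p.2 : ℕ) < n), Z.1 p.1 p.2 =
      ((phiCoeff n a b V - Matrix.diagonal fun p : Fin (2 * n) => vertexIndicator V p) *
        Z.1).trace := by
    rw [phiCoeff, add_sub_cancel_left, Finset.sum_filter, ← Finset.univ_product_univ,
      Finset.sum_product_right]
    simp only [Matrix.trace, Matrix.diag_apply, Matrix.mul_apply, Matrix.of_apply, ite_mul,
      one_mul, zero_mul]
  have vertices : ∑ i : Fin n with i ∈ V, Z.1 (lift i) (lift i) =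
      (Matrix.diagonal (fun p : Fin (2 * n) => vertexIndicator V p) * Z.1).trace := by
    simp only [sum_lift V fun p => Z.1 p p, Matrix.trace, Matrix.diag_apply,
      Matrix.diagonal_mul, smul_eq_mul]
  rw [phiOne, LinearMap.add_apply, LinearMap.sum_apply, LinearMap.sum_apply]
  change ∑ i : Fin n with i ∈ V, Z.1 (lift i) (lift i) +
    ∑ p : Fin (2 * n) × Fin (2 * n) with
        OrientedFullEdge n a b p.1 p.2 ∧ ((p.1 : ℕ) < n ∨ (p.2 : ℕ) < n), Z.1 p.1 p.2 = _
  rw [edges, vertices, sub_mul, Matrix.trace_sub, add_sub_cancel]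

open Classical in
theorem phiCoeff_apply_of_ne {i j : Fin (2 * n)} (hij : i ≠ j) :
    phiCoeff n a b V j i =
      if OrientedFullEdge n a b i j ∧ ((i : ℕ) < n ∨ (j : ℕ) < n) then 1 else 0 := by
  rw [phiCoeff, Matrix.add_apply, Matrix.diagonal_apply_ne _ hij.symm, zero_add, Matrix.of_apply]

theorem phiMatrix_ne_zero_iff (V : Set (Fin n)) (ha : a.sum ≤ n) (hb : b.sum ≤ n)
    {i j : Fin (2 * n)} (hij : i ≠ j) :
    phiMatrix n a b V j i ≠ 0 ↔ OrientedFullEdge n a b i j := by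
  have rev_iff : OrientedFullEdge n a b j.rev i.rev ↔ OrientedFullEdge n a b i j :=
    ⟨fun h => by simpa using h.rev ha hb, fun h => h.rev ha hb⟩
  have rev_lt_iff (k : Fin (2 * n)) : (k.rev : ℕ) < n ↔ ¬ (k : ℕ) < n := by
    rw [Fin.val_rev]
    omega
  rw [phiMatrix, spPart_apply, phiCoeff_apply_of_ne hij,
    phiCoeff_apply_of_ne fun h => hij (Fin.rev_injective h).symm, rev_iff]
  by_cases edge : OrientedFullEdge n a b i j
  · simp only [edge, true_and, iff_true, indexSign, rev_lt_iff]
    by_cases hi : (i : ℕ) < n <;> by_cases hj : (j : ℕ) < n <;> simp [hi, hj]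
  · simp only [edge, false_and, if_false, mul_zero, sub_zero, ne_eq, not_true_eq_false]

theorem trace_mul_lie {m R : Type*} [Fintype m] [CommRing R] (A B C : Matrix m m R) :
    (A * ⁅B, C⁆).trace = (⁅A, B⁆ * C).trace := by
  rw [Ring.lie_def, Ring.lie_def, mul_sub, sub_mul, Matrix.trace_sub, Matrix.trace_sub,
    ← mul_assoc, ← mul_assoc, Matrix.trace_mul_cycle A C B]

theorem two_mul_kirillovForm_phiOne (X Y : seaweed n a b) :
    2 * kirillovForm (phiOne n a b V) X Y = (⁅phiMatrix n a b V, X.1⁆ * Y.1).trace := by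
  rw [← trace_mul_lie]
  change 2 * phiOne n a b V ⁅X, Y⁆ = _
  rw [phiOne_apply]
  exact (trace_spPart_mul (mem_seaweed.1 ⁅X, Y⁆.2).1).symm

theorem trace_mul_spPart_single {G : Matrix (Fin (2 * n)) (Fin (2 * n)) ℂ} (hG : G ∈ sp n)
    (i j : Fin (2 * n)) : (G * spPart n (Matrix.single i j 1)).trace = 2 * G j i := by
  rw [Matrix.trace_mul_comm, trace_spPart_mul hG, Matrix.trace_mul_comm, Matrix.trace_mul_single,
    MulOpposite.op_one, one_smul]

theorem mem_ker_kirillovForm_phiOne_iff (ha : a.sum ≤ n) (hb : b.sum ≤ n) {X : seaweed n a b} :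
    X ∈ LinearMap.ker (kirillovForm (phiOne n a b V)) ↔
      ∀ i j, Admissible n a b i j → ⁅phiMatrix n a b V, X.1⁆ j i = 0 := by
  rw [LinearMap.mem_ker]
  constructor
  · intro hX i j adm
    have hY : spPart n (Matrix.single i j 1) ∈ seaweed n a b :=
      spPart_mem_seaweed ha hb fun p q h => Matrix.single_apply_of_ne _ _ _ _ _ fun ⟨hp, hq⟩ =>
        h (hp ▸ hq ▸ adm)
    have mem_sp : ⁅phiMatrix n a b V, X.1⁆ ∈ sp n :=
      (sp n).lie_mem (spPart_mem_sp _) (mem_seaweed.1 X.2).1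
    have eq := two_mul_kirillovForm_phiOne X (V := V) ⟨_, hY⟩
    rw [trace_mul_spPart_single mem_sp, hX] at eq
    simpa using eq.symm
  · intro hX
    ext Y
    have eq := two_mul_kirillovForm_phiOne X (V := V) Y
    have trace_eq_zero : (⁅phiMatrix n a b V, X.1⁆ * Y.1).trace = 0 := by
      refine Finset.sum_eq_zero fun j _ => (Matrix.mul_apply ..).trans <|
        Finset.sum_eq_zero fun i _ => ?_
      by_cases adm : Admissible n a b i j
      · exact mul_eq_zero_of_left (hX i j adm) _
      · exact mul_eq_zero_of_right _ ((mem_seaweed.1 Y.2).2 i j adm)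
    rw [trace_eq_zero] at eq
    simpa using eq

/-- A `2n × 2n` matrix as a matrix indexed by `ℕ`, with zero entries outside the range. -/
noncomputable def extendZero (X : Matrix (Fin (2 * n)) (Fin (2 * n)) ℂ) (i j : ℕ) : ℂ :=
  if h : i < 2 * n ∧ j < 2 * n then X ⟨i, h.1⟩ ⟨j, h.2⟩ else 0

theorem extendZero_val (X : Matrix (Fin (2 * n)) (Fin (2 * n)) ℂ) (i j : Fin (2 * n)) :
    extendZero X i j = X i j :=
  dif_pos ⟨i.2, j.2⟩

theorem extendZero_ne_zero_iff {X : Matrix (Fin (2 * n)) (Fin (2 * n)) ℂ} {i j : ℕ} :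
    extendZero X i j ≠ 0 ↔ ∃ (hi : i < 2 * n) (hj : j < 2 * n), X ⟨i, hi⟩ ⟨j, hj⟩ ≠ 0 := by
  simp [extendZero]

theorem commOn_extendZero (F X : Matrix (Fin (2 * n)) (Fin (2 * n)) ℂ) (i j : Fin (2 * n)) :
    commOn (Ico 0 (2 * n)) (extendZero F) (extendZero X) i j = ⁅F, X⁆ i j := by
  rw [commOn, Nat.Ico_zero_eq_range, Finset.sum_range, Ring.lie_def, Matrix.sub_apply,
    Matrix.mul_apply, Matrix.mul_apply, ← Finset.sum_sub_distrib]
  simp only [extendZero_val]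

theorem isMeanderForm_extendZero_phiMatrix (V : Set (Fin n)) (h : HasTailGrading n 0 a b)
    (ha : a.sum ≤ n) (hb : b.sum ≤ n) :
    IsMeanderForm (2 * n) 0 (fullComposition n a) (fullComposition n b)
      (extendZero (phiMatrix n a b V)) where
  sum_top := by rw [zero_add, sum_fullComposition ha]
  sum_bottom := by rw [zero_add, sum_fullComposition hb]
  exists_grading := h.exists_isGraded_fullComposition ha hb
  ne_zero_iff {i j} hij := by
    have edge_iff (hj : j < 2 * n) (hi : i < 2 * n) :
        phiMatrix n a b V ⟨j, hj⟩ ⟨i, hi⟩ ≠ 0 ↔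
          DirectedArc 0 (fullComposition n a) (fullComposition n b) i j := by
      rw [phiMatrix_ne_zero_iff V ha hb (by simpa using hij), orientedFullEdge_iff]
    simp only [extendZero_ne_zero_iff, edge_iff, exists_prop, ← and_assoc, and_iff_right_iff_imp]
    exact fun arc => (arc.lt (sum_fullComposition ha).le (sum_fullComposition hb).le).symm

theorem mem_ker_kirillovForm_phiOne_iff_isDiagonalAlong (h : HasTailGrading n 0 a b)
    (ha : a.sum ≤ n) (hb : b.sum ≤ n) {X : seaweed n a b} :
    X ∈ LinearMap.ker (kirillovForm (phiOne n a b V)) ↔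
      IsDiagonalAlong (2 * n) 0 (fullComposition n a) (fullComposition n b)
        (extendZero X.1) := by
  have hF := isMeanderForm_extendZero_phiMatrix V h ha hb
  rw [mem_ker_kirillovForm_phiOne_iff ha hb]
  constructor
  · refine fun hX => InMeanderKernel.isDiagonalAlong ⟨fun {i j} _ ne => ?_, fun {i j} adm => ?_⟩ hF
    · obtain ⟨hi, hj, ne⟩ := extendZero_ne_zero_iff.1 ne
      exact admissible_iff.1 (by_contra fun adm => ne ((mem_seaweed.1 X.2).2 _ _ adm))
    · obtain ⟨hi, hj⟩ := adm.mem_Ico hF.sum_top hF.sum_bottom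
      rw [commOn_extendZero _ _ ⟨j, (mem_Ico.1 hj).2⟩ ⟨i, (mem_Ico.1 hi).2⟩]
      exact hX _ _ (admissible_iff.2 adm)
  · intro hX i j _
    rw [← commOn_extendZero]
    exact hF.commOn_eq_zero hX.isGraded hX.diagonal (mem_Ico.2 ⟨i.1.zero_le, i.2⟩)
      (mem_Ico.2 ⟨j.1.zero_le, j.2⟩)

theorem spPart_diagonal (d : ℕ → ℂ) :
    spPart n (Matrix.diagonal fun p : Fin (2 * n) => d p) =
      Matrix.diagonal fun p : Fin (2 * n) => d p - d (mirror 0 (2 * n) p) := by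
  ext p q
  rw [spPart_apply]
  by_cases hpq : p = q
  · rw [hpq, Matrix.diagonal_apply_eq, Matrix.diagonal_apply_eq, Matrix.diagonal_apply_eq,
      indexSign_mul_self, one_mul, val_rev_eq_mirror]
  · rw [Matrix.diagonal_apply_ne _ hpq, Matrix.diagonal_apply_ne _ hpq,
      Matrix.diagonal_apply_ne _ fun h => hpq (Fin.rev_injective h).symm, mul_zero, sub_zero]

theorem hOne_eq_spPart (V : Set (Fin n)) :
    hOne n V = spPart n (Matrix.diagonal fun p : Fin (2 * n) => vertexIndicator V p) := by
  classical
  have reflect : ∑ p : Fin (2 * n), vertexIndicator V p • Matrix.single p.rev p.rev (1 : ℂ) =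
      ∑ p : Fin (2 * n), Matrix.single p p (vertexIndicator V (mirror 0 (2 * n) p)) := by
    rw [← Equiv.sum_comp Fin.revPerm]
    simp only [Fin.revPerm_apply, Fin.rev_rev, val_rev_eq_mirror, Matrix.smul_single, smul_eq_mul,
      mul_one]
  rw [hOne, sum_lift V fun p => Matrix.single p p (1 : ℂ) - Matrix.single p.rev p.rev 1,
    spPart_diagonal, ← Matrix.diagonal_sub, ← Matrix.sum_single_eq_diagonal,
    ← Matrix.sum_single_eq_diagonal, ← reflect]
  simp only [smul_sub, Finset.sum_sub_distrib, Matrix.smul_single, smul_eq_mul, mul_one]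

theorem hOne_mem_seaweed (V : Set (Fin n)) (ha : a.sum ≤ n) (hb : b.sum ≤ n) :
    hOne n V ∈ seaweed n a b := by
  rw [hOne_eq_spPart]
  refine spPart_mem_seaweed ha hb fun i j adm => Matrix.diagonal_apply_ne _ ?_
  rintro rfl
  exact adm (.refl ha i)

theorem hOne_eq_diagonal (V : Set (Fin n)) :
    hOne n V = Matrix.diagonal fun p : Fin (2 * n) => oddExtension n (vertexIndicator V) p := by
  rw [hOne_eq_spPart, spPart_diagonal]
  congr! 2 with p
  by_cases hp : (p : ℕ) < n
  · rw [oddExtension_of_lt hp, vertexIndicator_of_le (i := mirror _ _ _)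
      (by unfold mirror; omega), sub_zero]
  · rw [oddExtension, if_neg hp, vertexIndicator_of_le (not_lt.1 hp), zero_sub]

theorem isDiagonalAlong_extendZero_diagonal {f : ℕ → ℂ} {c d : List ℕ} (hc : c.sum = 2 * n)
    (hd : d.sum = 2 * n) (hf : IsGraded 0 0 c d f) :
    IsDiagonalAlong (2 * n) 0 c d (extendZero (Matrix.diagonal fun p : Fin (2 * n) => f p)) where
  diagonal i hi j hj hij := by
    rw [extendZero_val _ ⟨i, (mem_Ico.1 hi).2⟩ ⟨j, (mem_Ico.1 hj).2⟩]
    exact Matrix.diagonal_apply_ne _ (by simpa using hij)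
  isGraded i j arc := by
    obtain ⟨hi, hj⟩ := arc.lt hc.le hd.le
    beta_reduce
    rw [extendZero_val _ ⟨i, hi⟩ ⟨i, hi⟩, extendZero_val _ ⟨j, hj⟩ ⟨j, hj⟩,
      Matrix.diagonal_apply_eq, Matrix.diagonal_apply_eq]
    exact hf arc

end KirillovForm

section Kernel

variable {n : ℕ} {a b : List ℕ} {P : (meander n a b).ConnectedComponent}

theorem IsTailFreePath.hOne_mem_ker (hP : IsTailFreePath n a b P) (h : HasTailGrading n 0 a b)
    (ha : a.sum ≤ n) (hb : b.sum ≤ n) :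
    (⟨hOne n P.supp, hOne_mem_seaweed P.supp ha hb⟩ : seaweed n a b) ∈
      LinearMap.ker (kirillovForm (phiOne n a b P.supp)) := by
  rw [mem_ker_kirillovForm_phiOne_iff_isDiagonalAlong h ha hb]
  simp only [hOne_eq_diagonal]
  exact isDiagonalAlong_extendZero_diagonal (sum_fullComposition ha) (sum_fullComposition hb)
    ((hP.isTailFreeInvariant ha hb).isGraded_oddExtension h ha hb)

theorem extendZero_mirror {X : Matrix (Fin (2 * n)) (Fin (2 * n)) ℂ} (hX : X ∈ sp n) {i : ℕ}
    (hi : i < 2 * n) :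
    extendZero X (mirror 0 (2 * n) i) (mirror 0 (2 * n) i) = -extendZero X i i := by
  lift i to Fin (2 * n) using hi
  rw [← val_rev_eq_mirror, extendZero_val, extendZero_val, mem_sp_iff_apply.1 hX, Fin.rev_rev,
    neg_mul, indexSign_mul_self, neg_one_mul]

theorem IsDiagonalAlong.eq_diagonal {X : Matrix (Fin (2 * n)) (Fin (2 * n)) ℂ} {c d : List ℕ}
    (h : IsDiagonalAlong (2 * n) 0 c d (extendZero X)) (hX : X ∈ sp n) :
    X = Matrix.diagonal fun p : Fin (2 * n) => oddExtension n (fun i => extendZero X i i) p := by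
  ext p q
  by_cases hpq : p = q
  · rw [hpq, Matrix.diagonal_apply_eq, oddExtension, extendZero_mirror hX q.2, neg_neg, ite_self,
      extendZero_val]
  · rw [Matrix.diagonal_apply_ne _ hpq, ← extendZero_val X]
    exact h.diagonal p (mem_Ico.2 ⟨p.1.zero_le, p.2⟩) q (mem_Ico.2 ⟨q.1.zero_le, q.2⟩)
      (Fin.val_ne_of_ne hpq)

theorem IsTailFreePath.eq_smul_hOne (hP : IsTailFreePath n a b P) {p : Fin 1 → ℕ}
    (hp : IsPathSystem ℂ n 0 a b p) (h : HasTailGrading n 0 a b) (ha : a.sum ≤ n)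
    (hb : b.sum ≤ n) {X : seaweed n a b}
    (hX : X ∈ LinearMap.ker (kirillovForm (phiOne n a b P.supp))) :
    X.1 = extendZero X.1 (p 0) (p 0) • hOne n P.supp := by
  rw [mem_ker_kirillovForm_phiOne_iff_isDiagonalAlong h ha hb] at hX
  have X_mem_sp : X.1 ∈ sp n := (mem_seaweed.1 X.2).1
  have invariant : IsTailFreeInvariant 0 a b fun i => extendZero X.1 i i :=
    hX.isGraded.isTailFreeInvariant_of_odd
      (fun i hi => extendZero_mirror X_mem_sp (by omega)) ha hb
  have scalar {i : ℕ} (hi : i < n) := hP.eq_mul_vertexIndicator hp ha hb invariant hi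
  rw [hOne_eq_diagonal, ← Matrix.diagonal_smul]
  refine (hX.eq_diagonal X_mem_sp).trans (congrArg Matrix.diagonal (funext fun q => ?_))
  rw [Pi.smul_apply, smul_eq_mul]
  by_cases hq : (q : ℕ) < n
  · rw [oddExtension_of_lt hq, oddExtension_of_lt hq, scalar hq]
  · rw [oddExtension, oddExtension, if_neg hq, if_neg hq, scalar (by unfold mirror; omega),
      mul_neg]

end Kernel

end SeaweedC

theorem theorem3p7 (n : ℕ) (a b : List ℕ)
    (ha : SeaweedC.IsPartialComposition n a) (hb : SeaweedC.IsPartialComposition n b)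
    (hH : ∃ s : ℕ, SeaweedC.HasHomotopyType n a b [1] (List.replicate s 1) 0) :
    (∃! P : (SeaweedC.meander n a b).ConnectedComponent, SeaweedC.IsTailFreePath n a b P) ∧
    ∀ P : (SeaweedC.meander n a b).ConnectedComponent, SeaweedC.IsTailFreePath n a b P →
      Submodule.map (SeaweedC.seaweed n a b).toSubmodule.subtype
          (LinearMap.ker (SeaweedC.kirillovForm (SeaweedC.phiOne n a b P.supp))) =
        Submodule.span ℂ {SeaweedC.hOne n P.supp} := by
  obtain ⟨s, k, w, hk⟩ := hH
  have k_le : k ≤ s := by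
    simp only [List.sum_replicate, smul_eq_mul, mul_one] at hk
    omega
  have ones : ∀ c ∈ [1], c = 1 := fun _ => List.mem_singleton.1
  have grading : SeaweedC.HasTailGrading n 0 a b := w.hasTailGrading ones k_le ha.2 hb.2
  obtain ⟨p, hp⟩ : ∃ p : Fin 1 → ℕ, SeaweedC.IsPathSystem ℂ n 0 a b p :=
    w.exists_isPathSystem ℂ ones k_le ha.2 hb.2
  refine ⟨hp.existsUnique_isTailFreePath ha.2 hb.2, fun P hP => le_antisymm ?_ ?_⟩
  · rintro _ ⟨X, hX, rfl⟩
    exact Submodule.mem_span_singleton.2 ⟨_, (hP.eq_smul_hOne hp grading ha.2 hb.2 hX).symm⟩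
  · rw [Submodule.span_singleton_le_iff_mem]
    exact ⟨_, hP.hOne_mem_ker grading ha.2 hb.2, rfl⟩
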